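/- A \emph{brace} means a skew left brace: a set $B$ with two group structures $(B,+)$ and $(B,\cdot)$ (neither assumed commutative) such that $a(b+c)=ab-a+ac$ for all $a,b,c\in B$. Put $\lambda_a(b)=-a+ab$. An \emph{ideal} of $B$ is a subset that is a normal subgroup of both $(B,+)$ and $(B,\cdot)$ and is invariant under every $\lambda_b$, $b\in B$; and $\operatorname{Soc}(B)=\{a\in B:\lambda_a=\mathrm{id}\}\cap Z(B,+)$. A brace $B$ is \emph{almost polycyclic} if it has a finite chain of ideals $\{0\}=J_0\leq J_1\leq\dots\leq J_n=B$ such that, for all $0\leq i<n$, either $J_{i+1}/J_i\leq\operatorname{Soc}(B/J_i)$ and $J_{i+1}/J_i$ is finitely generated, or $J_{i+1}/J_i$ is finite. A brace $B$ is \emph{supersoluble} if it has a finite chain of ideals $\{0\}=I_0\leq I_1\leq\dots\leq I_n=B$ such that, for all $0\leq i<n$, either $(I_{i+1}/I_i,+)$ is infinite cyclic and $I_{i+1}/I_i\leq\operatorname{Soc}(B/I_i)$, or $I_{i+1}/I_i$ has prime order. \textbf{Theorem.} Let $B$ be an almost polycyclic brace. Then $B$ is supersoluble if and only if all its finite homomorphic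 images are supersoluble. -/

import Mathlib

universe u

/-- A skew left brace: a set with two group structures `(B, +)` (not necessarily commutative)
and `(B, *)` such that `a * (b + c) = a * b - a + a * c`. -/
class SkewBrace (B : Type*) extends AddGroup B, Group B where
  mul_add_eq (a b c : B) : a * (b + c) = a * b - a + a * c

namespace SkewBrace

section Basic

variable {B : Type*} [SkewBrace B]

/-- The map `λ_a : b ↦ -a + a * b`. -/
def lam (a b : B) : B := -a + a * b

/-- The two identity elements coincide. -/
theorem one_eq_zero : (1 : B) = 0 := by
  have h := mul_add_eq (1 : B) 0 0
  simp only [one_mul, add_zero, zero_sub] at h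
  exact (neg_eq_zero.mp h.symm)

theorem mul_zero_eq (a : B) : a * 0 = a := by
  rw [← one_eq_zero, mul_one]

theorem lam_inv_neg_add (a b : B) : lam a⁻¹ (-a + b) = a⁻¹ * b := by
  have h := mul_add_eq a⁻¹ a (-a)
  rw [add_neg_cancel, mul_zero_eq, inv_mul_cancel, one_eq_zero, zero_sub] at h
  have h2 : a⁻¹ * (-a) = a⁻¹ + a⁻¹ := neg_add_eq_iff_eq_add.mp h.symm
  rw [lam, mul_add_eq, h2, add_sub_cancel_right, neg_add_cancel_left]

theorem lam_inv_mul (a b : B) : lam a (a⁻¹ * b) = -a + b := by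
  rw [lam, mul_inv_cancel_left]

end Basic

/-- A subbrace: a subset that is a subgroup of both `(B, +)` and `(B, *)`. -/
structure Subbrace (B : Type*) [SkewBrace B] extends AddSubgroup B where
  mul_mem' {a b : B} : a ∈ carrier → b ∈ carrier → a * b ∈ carrier
  inv_mem' {a : B} : a ∈ carrier → a⁻¹ ∈ carrier

instance (B : Type*) [SkewBrace B] : SetLike (Subbrace B) B where
  coe S := S.carrier
  coe_injective S T h := by
    obtain ⟨S, _, _⟩ := S
    obtain ⟨T, _, _⟩ := T
    have : S = T := SetLike.coe_injective h
    subst this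
    rfl

/-- A subbrace is finitely generated (as a brace) if it is the smallest subbrace containing
some finite set. -/
def Subbrace.FG {B : Type*} [SkewBrace B] (S : Subbrace B) : Prop :=
  ∃ E : Finset B, (E : Set B) ⊆ S ∧ ∀ T : Subbrace B, (E : Set B) ⊆ T → (S : Set B) ⊆ T

/-- An ideal: a subbrace invariant under all maps `λ_b`, normal in `(B, +)` and in `(B, *)`. -/
structure Ideal (B : Type*) [SkewBrace B] extends Subbrace B where
  lam_mem' (b : B) {a : B} : a ∈ carrier → lam b a ∈ carrier
  add_conj_mem' (b : B) {a : B} : a ∈ carrier → b + a + -b ∈ carrier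
  mul_conj_mem' (b : B) {a : B} : a ∈ carrier → b * a * b⁻¹ ∈ carrier

instance (B : Type*) [SkewBrace B] : SetLike (Ideal B) B where
  coe S := S.carrier
  coe_injective S T h := by
    obtain ⟨S, _, _, _⟩ := S
    obtain ⟨T, _, _, _⟩ := T
    have : S = T := SetLike.coe_injective h
    subst this
    rfl

section Quotient

variable {B : Type*} [SkewBrace B] (I : Ideal B)

instance Ideal.normal_toAddSubgroup : I.toAddSubgroup.Normal where
  conj_mem _ ha b := I.add_conj_mem' b ha

/-- The additive and multiplicative left cosets of an ideal coincide. -/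
theorem Ideal.inv_mul_mem_iff (a b : B) :
    a⁻¹ * b ∈ I.toAddSubgroup ↔ -a + b ∈ I.toAddSubgroup := by
  constructor
  · intro h
    rw [← lam_inv_mul]
    exact I.lam_mem' a h
  · intro h
    rw [← lam_inv_neg_add]
    exact I.lam_mem' a⁻¹ h

theorem Ideal.mul_rel {a a' b b' : B} (ha : -a + a' ∈ I.toAddSubgroup)
    (hb : -b + b' ∈ I.toAddSubgroup) : -(a * b) + a' * b' ∈ I.toAddSubgroup := by
  rw [← I.inv_mul_mem_iff] at ha hb ⊢
  have h1 := I.mul_conj_mem' b⁻¹ ha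
  have h2 := I.mul_mem' h1 hb
  have h3 : b⁻¹ * (a⁻¹ * a') * b⁻¹⁻¹ * (b⁻¹ * b') = (a * b)⁻¹ * (a' * b') := by group
  rw [h3] at h2
  exact h2

theorem Ideal.inv_rel {a a' : B} (ha : -a + a' ∈ I.toAddSubgroup) :
    -a⁻¹ + a'⁻¹ ∈ I.toAddSubgroup := by
  rw [← I.inv_mul_mem_iff] at ha ⊢
  have h1 := I.mul_conj_mem' a (I.inv_mem' ha)
  have h3 : a * (a⁻¹ * a')⁻¹ * a⁻¹ = a⁻¹⁻¹ * a'⁻¹ := by group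
  rw [h3] at h1
  exact h1

/-- The underlying type of the quotient `B / I`: the cosets of `I`. -/
abbrev Ideal.Quot : Type _ := B ⧸ I.toAddSubgroup

/-- The quotient map `B → B / I`. -/
abbrev Ideal.toQuot (b : B) : I.Quot := QuotientAddGroup.mk b

instance : Mul I.Quot where
  mul := _root_.Quotient.map₂ (· * ·) fun _ _ ha _ _ hb =>
    QuotientAddGroup.leftRel_apply.mpr
      (I.mul_rel (QuotientAddGroup.leftRel_apply.mp ha) (QuotientAddGroup.leftRel_apply.mp hb))

instance : One I.Quot where
  one := I.toQuot 1

instance : Inv I.Quot where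
  inv := _root_.Quotient.map (·⁻¹) fun _ _ ha =>
    QuotientAddGroup.leftRel_apply.mpr (I.inv_rel (QuotientAddGroup.leftRel_apply.mp ha))

theorem Ideal.toQuot_mul (a b : B) : I.toQuot (a * b) = I.toQuot a * I.toQuot b := rfl

theorem Ideal.toQuot_inv (a : B) : I.toQuot a⁻¹ = (I.toQuot a)⁻¹ := rfl

theorem Ideal.toQuot_add (a b : B) : I.toQuot (a + b) = I.toQuot a + I.toQuot b := rfl

theorem Ideal.toQuot_sub (a b : B) : I.toQuot (a - b) = I.toQuot a - I.toQuot b := rfl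

/-- The multiplicative group of `B / I`, with `(aI)(bI) = (ab)I`. -/
instance : Group I.Quot :=
  Group.ofLeftAxioms
    (by
      rintro ⟨a⟩ ⟨b⟩ ⟨c⟩
      exact congrArg I.toQuot (mul_assoc a b c))
    (by
      rintro ⟨a⟩
      exact congrArg I.toQuot (one_mul a))
    (by
      rintro ⟨a⟩
      exact congrArg I.toQuot (inv_mul_cancel a))

/-- The quotient brace `B / I`. -/
instance : SkewBrace I.Quot where
  mul_add_eq := by
    rintro ⟨a⟩ ⟨b⟩ ⟨c⟩
    exact congrArg I.toQuot (mul_add_eq a b c)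

/-- For ideals `I` and `J` (with `I ⊆ J` in all uses), the factor `J / I` as a subbrace of `B / I`:
the image of `J` under the quotient map. -/
def Ideal.factor (J : Ideal B) : Subbrace I.Quot where
  toAddSubgroup := J.toAddSubgroup.map (QuotientAddGroup.mk' I.toAddSubgroup)
  mul_mem' := by
    rintro _ _ ⟨a, ha, rfl⟩ ⟨b, hb, rfl⟩
    exact ⟨a * b, J.mul_mem' ha hb, rfl⟩
  inv_mem' := by
    rintro _ ⟨a, ha, rfl⟩
    exact ⟨a⁻¹, J.inv_mem' ha, rfl⟩

end Quotient

/-- The socle `Soc(B) = Ker λ ∩ Z(B, +)`. -/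
def socle (B : Type*) [SkewBrace B] : Set B :=
  {a | (∀ b : B, lam a b = b) ∧ a ∈ AddSubgroup.center B}

/-- `B` is almost polycyclic: there is a finite chain of ideals `{0} = J₀ ≤ J₁ ≤ … ≤ Jₙ = B` such
that each factor `Jᵢ₊₁ / Jᵢ` is either finitely generated and contained in `Soc(B / Jᵢ)`,
or finite. -/
def IsAlmostPolycyclic (B : Type*) [SkewBrace B] : Prop :=
  ∃ (n : ℕ) (J : ℕ → Ideal B), (J 0 : Set B) = {0} ∧ (J n : Set B) = Set.univ ∧
    ∀ i < n, (J i : Set B) ⊆ J (i + 1) ∧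
      ((((J i).factor (J (i + 1)) : Set (J i).Quot) ⊆ socle (J i).Quot ∧
          ((J i).factor (J (i + 1))).FG) ∨
        Finite ((J i).factor (J (i + 1))))

/-- `B` is supersoluble: there is a finite chain of ideals `{0} = I₀ ≤ I₁ ≤ … ≤ Iₙ = B` such
that for each factor `Iᵢ₊₁ / Iᵢ` either its additive group is infinite cyclic and it is contained
in `Soc(B / Iᵢ)`, or it has prime order. -/
def IsSupersoluble (B : Type*) [SkewBrace B] : Prop :=
  ∃ (n : ℕ) (I : ℕ → Ideal B), (I 0 : Set B) = {0} ∧ (I n : Set B) = Set.univ ∧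
    ∀ i < n, (I i : Set B) ⊆ I (i + 1) ∧
      ((Infinite ((I i).factor (I (i + 1))).toAddSubgroup ∧
          IsAddCyclic ((I i).factor (I (i + 1))).toAddSubgroup ∧
          ((I i).factor (I (i + 1)) : Set (I i).Quot) ⊆ socle (I i).Quot) ∨
        (Nat.card ((I i).factor (I (i + 1)))).Prime)

/-- A homomorphism of braces: a map preserving sums and products. -/
structure BraceHom (B C : Type*) [SkewBrace B] [SkewBrace C] where
  toFun : B → C
  map_add' (a b : B) : toFun (a + b) = toFun a + toFun b
  map_mul' (a b : B) : toFun (a * b) = toFun a * toFun b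

end SkewBrace

/-! ### Mertens-type estimates for sums over primes. -/

section PrimeSums

open Real Nat

/-! Supersolubility passes to a finite image because an infinite cyclic socle factor becomes a
finite cyclic socle factor; its subgroups are λ-invariant, hence give ideals, and it refines to
steps of prime order.

For the converse, every additive subgroup of an almost polycyclic brace is finitely generated, so
Noetherian induction on ideals reduces to an infinite B all of whose proper quotients are
supersoluble. It suffices to find an infinite cyclic ideal inside the socle. The socle is infinite
(`socle_infinite`) and is a finitely generated abelian group on which B acts through λ; its
invariant subgroups are ideals of B. A nonzero torsion-free invariant subgroup W of least rank is
rationally irreducible. For each prime p the quotient by pW is supersoluble, so B acts triangularly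
on W/pW. This forces B to act on W by scalars (`exists_forall_eq_zsmul_of_triangular_mod_primes`),
and any nonzero cyclic subgroup of W will do.

Scalarity has two sources. Modulo p the action has a one-dimensional quotient, which kills
commutators; by rational irreducibility the action is commutative, and each operator has an
irreducible minimal polynomial f. Triangularity makes f split modulo every p, and such an f is
linear (`natDegree_eq_one_of_forall_splits_map`).

The last fact, a familiar consequence of Chebotarev density, is proved by counting. Let n = deg f ≥
2. The form bⁿ f(a/b) is evaluated at differences of distinct points of an N × N square. The values
are nonzero with logarithm at most n log N + O(1), yet n roots modulo each prime p ≤ N² force an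
average logarithm of at least 2n log N - O(1). -/

theorem Nat.log_factorial_le_sum_primesLE (M : ℕ) :
    Real.log (M ! : ℝ) ≤ ∑ p ∈ Nat.primesLE M, Real.log p * (M / (p - 1)) := by
  rcases Nat.eq_zero_or_pos M with rfl | hM
  · simp
  have h0 : M ! ≠ 0 := Nat.factorial_ne_zero M
  have h1 : Real.log (M ! : ℝ) = ∑ p ∈ (M !).primeFactors, (M !).factorization p * Real.log p := by
    conv_lhs => rw [← Nat.prod_factorization_pow_eq_self h0]
    rw [Finsupp.prod, Nat.cast_prod, Real.log_prod]
    · simp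
    · intro p hp
      have : p ≠ 0 := (Nat.prime_of_mem_primeFactors hp).ne_zero
      positivity
  rw [h1]
  have hsub : (M !).primeFactors ⊆ Nat.primesLE M := by
    intro p hp
    rw [Nat.mem_primesLE]
    have hp' := Nat.prime_of_mem_primeFactors hp
    exact ⟨(hp'.dvd_factorial).mp (Nat.dvd_of_mem_primeFactors hp), hp'⟩
  have hterm : ∀ p ∈ Nat.primesLE M,
      ((M !).factorization p : ℝ) * Real.log p ≤ Real.log p * (M / (p - 1)) := by
    intro p hp
    rw [Nat.mem_primesLE] at hp
    have := Fact.mk hp.2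
    -- Legendre's formula: (p - 1) v_p(M!) is M minus a positive digit sum.
    have h2 := sub_one_mul_padicValNat_factorial_lt_of_ne_zero p hM.ne'
    rw [Nat.factorization_def _ hp.2, mul_comm]
    have hp1 : (1 : ℝ) < p := by exact_mod_cast hp.2.one_lt
    refine mul_le_mul_of_nonneg_left ?_ (Real.log_nonneg hp1.le)
    rw [le_div_iff₀ (by linarith)]
    have h3 : (((p - 1) * padicValNat p (M !) : ℕ) : ℝ) ≤ M := by exact_mod_cast h2.le
    rw [Nat.cast_mul, Nat.cast_sub hp.2.one_le] at h3
    push_cast at h3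
    linarith
  refine (Finset.sum_le_sum fun p hp => hterm p (hsub hp)).trans
    (Finset.sum_le_sum_of_subset_of_nonneg hsub ?_)
  intro p hp _
  rw [Nat.mem_primesLE] at hp
  have hp1 : (1 : ℝ) < p := by exact_mod_cast hp.2.one_lt
  exact mul_nonneg (Real.log_nonneg hp1.le) (div_nonneg (by positivity) (by linarith))

/-- Since log p ≤ 2√p, each term is at most 2 p^(-3/2), which is summable. The bound absorbs all
errors of order 1/p². -/
theorem Nat.exists_sum_log_div_sq_le :
    ∃ c : ℝ, ∀ s : Finset ℕ, ∑ p ∈ s, Real.log p / (p : ℝ) ^ 2 ≤ c := by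
  have hs : Summable fun n : ℕ => 2 * (1 / (n : ℝ) ^ (3 / 2 : ℝ)) :=
    (Real.summable_one_div_nat_rpow.mpr (by norm_num)).mul_left 2
  refine ⟨∑' n : ℕ, 2 * (1 / (n : ℝ) ^ (3 / 2 : ℝ)), fun s => ?_⟩
  refine (Finset.sum_le_sum fun p _ => ?_).trans (hs.sum_le_tsum s fun n _ => by positivity)
  rcases Nat.eq_zero_or_pos p with rfl | hp
  · simp
  have hp' : (0 : ℝ) < p := by exact_mod_cast hp
  have h := Real.log_le_rpow_div hp'.le (show (0 : ℝ) < 1 / 2 by norm_num)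
  rw [div_le_iff₀ (by positivity)]
  refine h.trans (le_of_eq ?_)
  have : (p : ℝ) ^ 2 = (p : ℝ) ^ (3 / 2 : ℝ) * (p : ℝ) ^ (1 / 2 : ℝ) := by
    rw [← Real.rpow_add hp', ← Real.rpow_natCast]; norm_num
  rw [this]
  field_simp

/-- The lower bound in Mertens' first theorem. -/
theorem Nat.exists_log_sub_le_sum_log_div :
    ∃ c : ℝ, ∀ M : ℕ, 0 < M → Real.log M - c ≤ ∑ p ∈ Nat.primesLE M, Real.log p / p := by
  obtain ⟨c, hc⟩ := Nat.exists_sum_log_div_sq_le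
  -- The 1 comes from log M! ≥ M log M - M, the 2c from 1/(p - 1) ≤ 1/p + 2/p².
  refine ⟨1 + 2 * c, fun M hM => ?_⟩
  have hM' : (0 : ℝ) < M := by exact_mod_cast hM
  have h1 := Nat.log_factorial_le_sum_primesLE M
  have h2 := Stirling.le_log_factorial_stirling hM.ne'
  have h3 : 0 ≤ Real.log M := Real.log_nonneg (by exact_mod_cast hM)
  have h4 : 0 ≤ Real.log (2 * π) := Real.log_nonneg (by nlinarith [Real.pi_gt_three])
  have h5 : ∑ p ∈ Nat.primesLE M, Real.log p * (M / (p - 1)) ≤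
      M * (∑ p ∈ Nat.primesLE M, Real.log p / p + 2 * ∑ p ∈ Nat.primesLE M,
        Real.log p / (p : ℝ) ^ 2) := by
    rw [Finset.mul_sum, ← Finset.sum_add_distrib, Finset.mul_sum]
    refine Finset.sum_le_sum fun p hp => ?_
    rw [Nat.mem_primesLE] at hp
    have hp1 : (2 : ℝ) ≤ p := by exact_mod_cast hp.2.two_le
    have hl : 0 ≤ Real.log p := Real.log_nonneg (by linarith)
    have h6 : 1 / ((p : ℝ) - 1) ≤ 1 / p + 2 / (p : ℝ) ^ 2 := by
      have e : 1 / (p : ℝ) + 2 / (p : ℝ) ^ 2 = (p + 2) / (p : ℝ) ^ 2 := by field_simp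
      rw [e, div_le_div_iff₀ (by linarith) (by positivity)]
      nlinarith
    calc Real.log p * (M / (p - 1)) = (M * Real.log p) * (1 / (p - 1)) := by ring
      _ ≤ (M * Real.log p) * (1 / p + 2 / (p : ℝ) ^ 2) :=
        mul_le_mul_of_nonneg_left h6 (by positivity)
      _ = _ := by ring
  have h7 := hc (Nat.primesLE M)
  have h8 : M * (Real.log M - 1) ≤
      M * (∑ p ∈ Nat.primesLE M, Real.log p / p + 2 * ∑ p ∈ Nat.primesLE M,
        Real.log p / (p : ℝ) ^ 2) := by
    nlinarith
  have h9 := le_of_mul_le_mul_left h8 hM'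
  linarith

/-- The product of the distinct primes dividing m divides m. -/
theorem Int.sum_log_primes_dvd_le {m : ℤ} (hm : m ≠ 0) (P : Finset ℕ) (hP : ∀ p ∈ P, p.Prime) :
    ∑ p ∈ P.filter (fun p : ℕ => (p : ℤ) ∣ m), Real.log p ≤ Real.log |(m : ℝ)| := by
  rw [← Real.log_prod (fun p hp => by
    have := (hP p (Finset.mem_filter.mp hp).1).ne_zero; positivity), ← Nat.cast_prod]
  have hd : ∏ p ∈ P.filter (fun p : ℕ => (p : ℤ) ∣ m), p ∣ m.natAbs :=
    Finset.prod_primes_dvd _ (fun p hp => (hP p (Finset.mem_filter.mp hp).1).prime)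
      (fun p hp => Int.natCast_dvd.mp (Finset.mem_filter.mp hp).2)
  have hle := Nat.le_of_dvd (Int.natAbs_pos.mpr hm) hd
  have hpos : 0 < ∏ p ∈ P.filter (fun p : ℕ => (p : ℤ) ∣ m), p :=
    Finset.prod_pos fun p hp => (hP p (Finset.mem_filter.mp hp).1).pos
  rw [← Int.cast_abs, Int.abs_eq_natAbs, Int.cast_natCast]
  exact Real.log_le_log (by exact_mod_cast hpos) (by exact_mod_cast hle)

end PrimeSums

/-! ### Counting coincidences modulo p. -/

section Counting

/-- Cauchy–Schwarz applied to the sizes of the fibres of φ. -/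
theorem Finset.card_sq_le_card_mul_card_filter_eq {α β : Type*} [DecidableEq β] [Fintype β]
    (U : Finset α) (φ : α → β) :
    U.card ^ 2 ≤ Fintype.card β * ((U ×ˢ U).filter fun x => φ x.1 = φ x.2).card := by
  classical
  have h1 : ((U ×ˢ U).filter fun x => φ x.1 = φ x.2).card
      = ∑ c : β, (U.filter fun u => φ u = c).card ^ 2 := by
    rw [Finset.card_eq_sum_card_fiberwise (f := fun x => φ x.1) (t := Finset.univ) (by simp)]
    refine Finset.sum_congr rfl fun c _ => ?_
    rw [sq, ← Finset.card_product]
    congr 1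
    ext ⟨u, v⟩
    simp only [Finset.mem_filter, Finset.mem_product]
    constructor
    · rintro ⟨⟨⟨hu, hv⟩, h⟩, rfl⟩; exact ⟨⟨hu, rfl⟩, hv, h.symm⟩
    · rintro ⟨⟨hu, rfl⟩, hv, h⟩; exact ⟨⟨⟨hu, hv⟩, h.symm⟩, rfl⟩
  have h2 : U.card = ∑ c : β, (U.filter fun u => φ u = c).card :=
    Finset.card_eq_sum_card_fiberwise (by simp)
  rw [h1, h2]
  exact sq_sum_le_card_mul_sum_sq

theorem Nat.card_filter_range_cast_eq_le {p : ℕ} (hp : 0 < p) (N a : ℕ) :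
    ((Finset.range N).filter fun b : ℕ => (a : ZMod p) = b).card ≤ N / p + 1 := by
  have h : ((Finset.range N).filter fun b : ℕ => (a : ZMod p) = b)
      = (Finset.range N).filter fun b : ℕ => b ≡ a [MOD p] := by
    ext b
    simp only [Finset.mem_filter, ZMod.natCast_eq_natCast_iff]
    exact and_congr_right fun _ => ⟨Nat.ModEq.symm, Nat.ModEq.symm⟩
  rw [h, ← Nat.count_eq_card_filter_range, Nat.count_modEq_card _ hp]
  split_ifs <;> omega

/-- Pairs congruent in both coordinates coincide for every root at once, so their overcount has to
be controlled. -/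
theorem Nat.card_filter_square_cast_eq_le {p : ℕ} (hp : 0 < p) (N : ℕ) :
    (((Finset.range N ×ˢ Finset.range N) ×ˢ (Finset.range N ×ˢ Finset.range N)).filter
      fun x => (x.1.1 : ZMod p) = x.2.1 ∧ (x.1.2 : ZMod p) = x.2.2).card
      ≤ N ^ 2 * (N / p + 1) ^ 2 := by
  rw [Finset.card_filter, Finset.sum_product]
  have : ∀ u ∈ Finset.range N ×ˢ Finset.range N,
      (∑ v ∈ Finset.range N ×ˢ Finset.range N,
        if (u.1 : ZMod p) = v.1 ∧ (u.2 : ZMod p) = v.2 then 1 else 0) ≤ (N / p + 1) ^ 2 := by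
    intro u _
    rw [← Finset.card_filter, Finset.filter_product (fun b => (u.1 : ZMod p) = (b : ℕ))
      (fun b => (u.2 : ZMod p) = (b : ℕ)), Finset.card_product, sq]
    exact Nat.mul_le_mul (Nat.card_filter_range_cast_eq_le hp N _)
      (Nat.card_filter_range_cast_eq_le hp N _)
  refine (Finset.sum_le_card_nsmul _ _ _ this).trans (le_of_eq ?_)
  simp [sq]

end Counting

/-! ### The binary form attached to a polynomial. -/

namespace Polynomial

/-- The value of `f.scaleRoots b` at a is the form bⁿ f(a/b); for a = rb modulo p it becomes bⁿ
f(r). -/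
theorem dvd_eval_scaleRoots {f : ℤ[X]} {p : ℕ} {r : ZMod p}
    (hr : (f.map (Int.castRingHom (ZMod p))).eval r = 0) {a b : ℤ}
    (h : (a : ZMod p) = r * b) : (p : ℤ) ∣ (f.scaleRoots b).eval a := by
  rw [← ZMod.intCast_zmod_eq_zero_iff_dvd]
  have h1 := scaleRoots_eval₂_mul (p := f) (Int.castRingHom (ZMod p)) r b
  rw [← eval_map _ r, hr, mul_zero] at h1
  have h2 : (Int.castRingHom (ZMod p)) b * r = Int.castRingHom (ZMod p) a := by
    rw [eq_intCast, eq_intCast, h, mul_comm]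
  rw [h2, eval₂_at_apply] at h1
  simpa using h1

/-- If b ≠ 0, a zero would give the rational root a/b; if b = 0, only the leading term aⁿ survives.
-/
theorem eval_scaleRoots_ne_zero {f : ℤ[X]} (hm : f.Monic) (hirr : Irreducible f)
    (hd : 2 ≤ f.natDegree) {a b : ℤ} (h : (a, b) ≠ (0, 0)) : (f.scaleRoots b).eval a ≠ 0 := by
  by_cases hb : b = 0
  · subst hb
    have ha : a ≠ 0 := by rintro rfl; exact h rfl
    rw [eval_eq_sum_range, natDegree_scaleRoots, Finset.sum_range_succ, Finset.sum_eq_zero]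
    · simp [hm, ha]
    · intro i hi
      have := Finset.mem_range.mp hi
      have : f.natDegree - i ≠ 0 := by omega
      rw [coeff_scaleRoots, zero_pow this, mul_zero, zero_mul]
  · intro h0
    have hq := (hm.irreducible_iff_irreducible_map_fraction_map (K := ℚ)).mp hirr
    have hb' : (b : ℚ) ≠ 0 := by exact_mod_cast hb
    have h1 := scaleRoots_eval₂_mul (p := f) (algebraMap ℤ ℚ) (a / b : ℚ) b
    have h2 : (algebraMap ℤ ℚ) b * (a / b : ℚ) = algebraMap ℤ ℚ a := by
      simp; field_simp
    rw [h2, eval₂_at_apply, h0, map_zero, ← eval_map] at h1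
    have h3 : (f.map (algebraMap ℤ ℚ)).IsRoot (a / b) := by
      have : (algebraMap ℤ ℚ) b ^ f.natDegree ≠ 0 := pow_ne_zero _ (by simpa using hb)
      exact (mul_eq_zero.mp h1.symm).resolve_left this
    have h4 := degree_eq_one_of_irreducible_of_root hq h3
    have h5 : (f.map (algebraMap ℤ ℚ)).natDegree = 1 := natDegree_eq_of_degree_eq_some h4
    rw [hm.natDegree_map] at h5
    omega

theorem abs_eval_scaleRoots_le (f : ℤ[X]) {a b N : ℤ} (ha : |a| ≤ N) (hb : |b| ≤ N) :
    |(f.scaleRoots b).eval a| ≤ (∑ i ∈ Finset.range (f.natDegree + 1), |f.coeff i|)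
      * N ^ f.natDegree := by
  have hN : 0 ≤ N := (abs_nonneg a).trans ha
  rw [eval_eq_sum_range, natDegree_scaleRoots, Finset.sum_mul]
  refine (Finset.abs_sum_le_sum_abs _ _).trans (Finset.sum_le_sum fun i hi => ?_)
  have hi' : f.natDegree - i + i = f.natDegree := by
    have := Finset.mem_range.mp hi; omega
  rw [coeff_scaleRoots, abs_mul, abs_mul, abs_pow, abs_pow, mul_assoc]
  refine mul_le_mul_of_nonneg_left ?_ (abs_nonneg _)
  calc |b| ^ (f.natDegree - i) * |a| ^ i ≤ N ^ (f.natDegree - i) * N ^ i := by gcongr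
    _ = N ^ f.natDegree := by rw [← pow_add, hi']

/-- If `f` has `n = natDegree f` distinct roots modulo `p`, then the form associated with `f`
vanishes modulo `p` at about `n / p` of all differences of two points of a square. -/
theorem natDegree_mul_le_card_filter_dvd {f : ℤ[X]} {p : ℕ} [Fact p.Prime]
    (R : Finset (ZMod p)) (hR : R.card = f.natDegree)
    (hroot : ∀ r ∈ R, (f.map (Int.castRingHom (ZMod p))).eval r = 0) (N : ℕ) :
    f.natDegree * N ^ 4 ≤ p * (((Finset.range N ×ˢ Finset.range N).offDiag.filter fun x =>
        (p : ℤ) ∣ (f.scaleRoots ((x.1.2 : ℤ) - x.2.2)).eval ((x.1.1 : ℤ) - x.2.1)).card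
        + N ^ 2 + f.natDegree * (N ^ 2 * (N / p + 1) ^ 2)) := by
  classical
  set U := Finset.range N ×ˢ Finset.range N with hU
  have hUc : U.card = N ^ 2 := by simp [hU, sq]
  set D : (ℕ × ℕ) × (ℕ × ℕ) → Prop := fun x =>
    (p : ℤ) ∣ (f.scaleRoots ((x.1.2 : ℤ) - x.2.2)).eval ((x.1.1 : ℤ) - x.2.1) with hD
  -- Two points share a value of φ r exactly when their difference (a, b) satisfies a = rb, which
  -- makes the form vanish modulo p.
  let φ : ZMod p → ℕ × ℕ → ZMod p := fun r u => u.1 - r * u.2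
  let E : (ℕ × ℕ) × (ℕ × ℕ) → Prop := fun x =>
    (x.1.1 : ZMod p) = x.2.1 ∧ (x.1.2 : ZMod p) = x.2.2
  -- Collisions for two roots r ≠ s force both coordinates to agree modulo p. Outside E a pair thus
  -- collides for at most one root.
  have hpt : ∀ x ∈ U ×ˢ U, (∑ r ∈ R, if φ r x.1 = φ r x.2 then 1 else 0)
      ≤ (if D x then 1 else 0) + f.natDegree * (if E x then 1 else 0) := by
    intro x _
    by_cases hE : E x
    · rw [if_pos hE, mul_one, ← hR]
      refine (Finset.sum_le_card_nsmul R _ 1 (fun r _ => by split_ifs <;> simp)).trans ?_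
      simp
    · rw [if_neg hE, mul_zero, add_zero, ← Finset.card_filter]
      by_cases hD' : D x
      · rw [if_pos hD', Finset.card_le_one]
        intro r hr s hs
        have h1 := (Finset.mem_filter.mp hr).2
        have h2 := (Finset.mem_filter.mp hs).2
        simp only [φ] at h1 h2
        by_contra hrs
        have h3 : (r - s) * ((x.1.2 : ZMod p) - x.2.2) = 0 := by linear_combination h2 - h1
        have h4 : (x.1.2 : ZMod p) = x.2.2 :=
          sub_eq_zero.mp ((mul_eq_zero.mp h3).resolve_left (sub_ne_zero.mpr hrs))
        refine hE ⟨?_, h4⟩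
        linear_combination h1 + r * h4
      · rw [if_neg hD', Nat.le_zero, Finset.card_eq_zero, Finset.filter_eq_empty_iff]
        intro r hr h1
        apply hD'
        refine dvd_eval_scaleRoots (hroot r hr) ?_
        simp only [φ] at h1
        push_cast
        linear_combination h1
  have hsum := Finset.sum_le_sum hpt
  rw [Finset.sum_comm, Finset.sum_add_distrib, ← Finset.mul_sum, ← Finset.card_filter,
    ← Finset.card_filter] at hsum
  simp only [← Finset.card_filter] at hsum
  have hE := Nat.card_filter_square_cast_eq_le (Fact.out : p.Prime).pos N
  have hDle : ((U ×ˢ U).filter D).card ≤ (U.offDiag.filter D).card + N ^ 2 := by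
    rw [← Finset.diag_union_offDiag, Finset.filter_union]
    refine (Finset.card_union_le _ _).trans ?_
    rw [add_comm]
    refine Nat.add_le_add_left ((Finset.card_filter_le _ _).trans ?_) _
    rw [Finset.diag_card, hUc]
  -- Each root produces at least N⁴/p collisions, as φ r takes at most p values on N² points.
  have hr : ∀ r ∈ R, N ^ 4 ≤ p * ((U ×ˢ U).filter fun x => φ r x.1 = φ r x.2).card := by
    intro r _
    have := Finset.card_sq_le_card_mul_card_filter_eq U (φ r)
    rw [hUc, ZMod.card, ← pow_mul] at this
    exact this
  have hr' := Finset.sum_le_sum hr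
  rw [Finset.sum_const, smul_eq_mul, hR, ← Finset.mul_sum] at hr'
  refine hr'.trans (Nat.mul_le_mul_left _ (hsum.trans ?_))
  exact Nat.add_le_add hDle (Nat.mul_le_mul_left _ hE)

end Polynomial

/-! ### Polynomials that split modulo every prime. -/

namespace Polynomial

/-- Clear denominators in a Bézout relation over ℚ. -/
theorem exists_mul_add_mul_eq_C {f g : ℤ[X]}
    (h : IsCoprime (f.map (algebraMap ℤ ℚ)) (g.map (algebraMap ℤ ℚ))) :
    ∃ (u v : ℤ[X]) (D : ℤ), D ≠ 0 ∧ u * f + v * g = C D := by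
  obtain ⟨a, b, hab⟩ := h
  obtain ⟨c, hcM, hc⟩ := IsLocalization.integerNormalization_spec (nonZeroDivisors ℤ) a
  obtain ⟨d, hdM, hd⟩ := IsLocalization.integerNormalization_spec (nonZeroDivisors ℤ) b
  refine ⟨C d * IsLocalization.integerNormalization (nonZeroDivisors ℤ) a,
    C c * IsLocalization.integerNormalization (nonZeroDivisors ℤ) b, c * d,
    mul_ne_zero (nonZeroDivisors.ne_zero hcM) (nonZeroDivisors.ne_zero hdM), ?_⟩
  apply map_injective (algebraMap ℤ ℚ) (algebraMap ℤ ℚ).injective_int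
  have e : ∀ (z : ℤ) (q : ℚ[X]), z • q = C (algebraMap ℤ ℚ z) * q := fun z q => by
    simp
  rw [e] at hc hd
  simp only [Polynomial.map_add, Polynomial.map_mul, map_C, hc, hd, map_mul]
  linear_combination (C (algebraMap ℤ ℚ c) * C (algebraMap ℤ ℚ d)) * hab

/-- For p not dividing D the relation survives reduction and makes f separable modulo p, so its
roots there are distinct. -/
theorem exists_card_eq_natDegree_of_splits {f : ℤ[X]} (hm : f.Monic) {u v : ℤ[X]} {D : ℤ}
    (h : u * f + v * derivative f = C D) {p : ℕ} [Fact p.Prime] (hp : ¬ (p : ℤ) ∣ D)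
    (hs : (f.map (Int.castRingHom (ZMod p))).Splits) :
    ∃ R : Finset (ZMod p), R.card = f.natDegree ∧
      ∀ r ∈ R, (f.map (Int.castRingHom (ZMod p))).eval r = 0 := by
  classical
  have hD : (D : ZMod p) ≠ 0 := by rwa [Ne, ZMod.intCast_zmod_eq_zero_iff_dvd]
  have hsep : (f.map (Int.castRingHom (ZMod p))).Separable := by
    refine ⟨C (D : ZMod p)⁻¹ * u.map (Int.castRingHom (ZMod p)),
      C (D : ZMod p)⁻¹ * v.map (Int.castRingHom (ZMod p)), ?_⟩
    have h' := congrArg (map (Int.castRingHom (ZMod p))) h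
    simp only [Polynomial.map_add, Polynomial.map_mul, map_C] at h'
    rw [eq_intCast (Int.castRingHom (ZMod p)) D] at h'
    rw [derivative_map, mul_assoc, mul_assoc, ← mul_add, h', ← C_mul, inv_mul_cancel₀ hD, C_1]
  refine ⟨(f.map (Int.castRingHom (ZMod p))).roots.toFinset, ?_, ?_⟩
  · rw [Multiset.toFinset_card_of_nodup (nodup_roots hsep), splits_iff_card_roots.mp hs,
      hm.natDegree_map]
  · intro r hr
    rw [Multiset.mem_toFinset] at hr
    exact isRoot_of_mem_roots hr

/-- A monic irreducible integer polynomial which splits modulo every prime is linear. -/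
theorem natDegree_eq_one_of_forall_splits_map {f : ℤ[X]} (hm : f.Monic) (hirr : Irreducible f)
    (hs : ∀ p : ℕ, p.Prime → (f.map (Int.castRingHom (ZMod p))).Splits) : f.natDegree = 1 := by
  classical
  have hn0 : f.natDegree ≠ 0 := fun h0 => hirr.not_isUnit (by
    rw [hm.natDegree_eq_zero.mp h0]; exact isUnit_one)
  by_contra hn1
  have hn : 2 ≤ f.natDegree := by omega
  have hq := (hm.irreducible_iff_irreducible_map_fraction_map (K := ℚ)).mp hirr
  obtain ⟨u, v, D, hD, huv⟩ := exists_mul_add_mul_eq_C (f := f) (g := derivative f) (by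
    rw [← derivative_map]; exact hq.separable)
  obtain ⟨c₁, hc₁⟩ := Nat.exists_log_sub_le_sum_log_div
  obtain ⟨c₂, hc₂⟩ := Nat.exists_sum_log_div_sq_le
  set n := f.natDegree with hn_def
  set A : ℤ := ∑ i ∈ Finset.range (n + 1), |f.coeff i| with hA
  have hA1 : 1 ≤ A := by
    have : |f.coeff n| ≤ A :=
      Finset.single_le_sum (f := fun i => |f.coeff i|) (fun i _ => abs_nonneg _) (by simp)
    rwa [hm.coeff_natDegree, abs_one] at this
  have hA1' : (1 : ℝ) ≤ A := by exact_mod_cast hA1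
  -- K gathers every term of the final comparison other than n log N: dividing by N⁴ leaves n log N
  -- ≤ K, which the choice of N violates.
  set K : ℝ := Real.log A + n * (c₁ + Real.log |(D : ℝ)|) + (2 * n + 1) * Real.log 4 + 2 * n * c₂
    with hK
  obtain ⟨N, hN1, hNK⟩ : ∃ N : ℕ, 0 < N ∧ K < n * Real.log N := by
    have ht : Filter.Tendsto (fun N : ℕ => (n : ℝ) * Real.log N) Filter.atTop Filter.atTop :=
      (Real.tendsto_log_atTop.comp tendsto_natCast_atTop_atTop).const_mul_atTop
        (by exact_mod_cast Nat.pos_of_ne_zero hn0)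
    obtain ⟨N, h1, h2⟩ := ((Filter.eventually_gt_atTop 0).and (ht.eventually_gt_atTop K)).exists
    exact ⟨N, h1, h2⟩
  have hN1' : (1 : ℝ) ≤ N := by exact_mod_cast hN1
  -- The cutoff N² makes the sum of log p / p about 2 log N, while Chebyshev's bound θ(N²) = O(N²)
  -- keeps the error terms at O(N⁴).
  set P := (Nat.primesLE (N ^ 2)).filter fun p : ℕ => ¬ (p : ℤ) ∣ D with hP
  have hPp : ∀ p ∈ P, p.Prime := fun p hp =>
    (Nat.mem_primesLE.mp (Finset.mem_filter.mp hp).1).2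
  set U := (Finset.range N ×ˢ Finset.range N).offDiag with hU
  set F : (ℕ × ℕ) × (ℕ × ℕ) → ℤ := fun x =>
    (f.scaleRoots ((x.1.2 : ℤ) - x.2.2)).eval ((x.1.1 : ℤ) - x.2.1) with hF
  have hUc : (U.card : ℝ) ≤ N ^ 4 := by
    have : U.card ≤ N ^ 4 := by
      rw [hU, Finset.offDiag_card, Finset.card_product, Finset.card_range]
      refine (Nat.sub_le _ _).trans (le_of_eq (by ring))
    exact_mod_cast this
  have hFne : ∀ x ∈ U, F x ≠ 0 := by
    rintro ⟨⟨a, b⟩, ⟨c, d⟩⟩ hx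
    refine eval_scaleRoots_ne_zero hm hirr hn ?_
    intro h
    have h' := (Finset.mem_offDiag.mp hx).2.2
    simp only [Prod.mk.injEq, sub_eq_zero, Nat.cast_inj] at h
    exact h' (by rw [h.1, h.2])
  have hFle : ∀ x ∈ U, Real.log |(F x : ℝ)| ≤ Real.log A + n * Real.log N := by
    intro x hx
    have hx' := Finset.mem_offDiag.mp hx
    simp only [Finset.mem_product, Finset.mem_range] at hx'
    have hb := abs_eval_scaleRoots_le f (a := (x.1.1 : ℤ) - x.2.1) (b := (x.1.2 : ℤ) - x.2.2)
      (N := N) (by rw [abs_le]; omega) (by rw [abs_le]; omega)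
    have hb' : |(F x : ℝ)| ≤ A * N ^ n := by
      have hb'' : |F x| ≤ A * (N : ℤ) ^ n := hb
      rw [← Int.cast_abs]; exact_mod_cast hb''
    refine (Real.log_le_log (abs_pos.mpr (by exact_mod_cast hFne x hx)) hb').trans (le_of_eq ?_)
    rw [Real.log_mul (by positivity) (by positivity), Real.log_pow]
  -- Double counting: for a fixed pair, the primes dividing its value contribute at most the
  -- logarithm of that value.
  have hupper : ∑ p ∈ P, Real.log p * (U.filter fun x => (p : ℤ) ∣ F x).card
      ≤ N ^ 4 * (Real.log A + n * Real.log N) := by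
    have h1 : ∑ p ∈ P, Real.log p * (U.filter fun x => (p : ℤ) ∣ F x).card
        = ∑ x ∈ U, ∑ p ∈ P.filter (fun p : ℕ => (p : ℤ) ∣ F x), Real.log p := by
      simp only [Finset.sum_filter, Finset.card_filter, Nat.cast_sum, Finset.mul_sum]
      rw [Finset.sum_comm]
      refine Finset.sum_congr rfl fun x _ => Finset.sum_congr rfl fun p _ => ?_
      split_ifs <;> simp
    rw [h1]
    have hnn : 0 ≤ Real.log A + n * Real.log N :=
      add_nonneg (Real.log_nonneg hA1') (mul_nonneg (by positivity) (Real.log_nonneg hN1'))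
    calc _ ≤ ∑ x ∈ U, (Real.log A + n * Real.log N) := Finset.sum_le_sum fun x hx =>
            (Int.sum_log_primes_dvd_le (hFne x hx) P hPp).trans (hFle x hx)
      _ = U.card * (Real.log A + n * Real.log N) := by
        rw [Finset.sum_const, nsmul_eq_mul]
      _ ≤ _ := mul_le_mul_of_nonneg_right hUc hnn
  -- The coefficient 2n + 1 collects N² from the diagonal and 2nN² from (q + 1)² ≤ 2q² + 2 with q
  -- the integer part of N/p.
  have hlower : ∀ p ∈ P, n * N ^ 4 * (Real.log p / p) - (2 * n + 1) * N ^ 2 * Real.log p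
      - 2 * n * N ^ 4 * (Real.log p / (p : ℝ) ^ 2)
      ≤ Real.log p * (U.filter fun x => (p : ℤ) ∣ F x).card := by
    intro p hp
    have hpp := hPp p hp
    have := Fact.mk hpp
    obtain ⟨R, hR, hroot⟩ := exists_card_eq_natDegree_of_splits hm huv
      (Finset.mem_filter.mp hp).2 (hs p hpp)
    have h1 : n * N ^ 4 ≤ p * ((U.filter fun x => (p : ℤ) ∣ F x).card + N ^ 2
        + n * (N ^ 2 * (N / p + 1) ^ 2)) := natDegree_mul_le_card_filter_dvd R hR hroot N
    have hp1 : (1 : ℝ) ≤ p := by exact_mod_cast hpp.one_le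
    have hp0 : (0 : ℝ) < p := by linarith
    have h2 : (n : ℝ) * N ^ 4 ≤ p * ((U.filter fun x => (p : ℤ) ∣ F x).card
        + N ^ 2 + n * (N ^ 2 * (((N / p : ℕ) : ℝ) + 1) ^ 2)) := by exact_mod_cast h1
    have h3 : ((N / p : ℕ) : ℝ) ≤ N / p := Nat.cast_div_le
    have h4 : (((N / p : ℕ) : ℝ) + 1) ^ 2 ≤ 2 * (N / p : ℝ) ^ 2 + 2 := by
      have h0 : (0 : ℝ) ≤ ((N / p : ℕ) : ℝ) := by positivity
      nlinarith [sq_nonneg (((N / p : ℕ) : ℝ) - 1)]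
    have h5 : (n : ℝ) * N ^ 4 / p ≤ (U.filter fun x => (p : ℤ) ∣ F x).card
        + N ^ 2 + n * (N ^ 2 * (2 * (N / p : ℝ) ^ 2 + 2)) := by
      rw [div_le_iff₀' hp0]
      refine h2.trans ?_
      gcongr
    have h6 := mul_le_mul_of_nonneg_left h5 (Real.log_nonneg hp1)
    have e : (n : ℝ) * (N ^ 2 * (2 * (N / p : ℝ) ^ 2 + 2))
        = 2 * n * N ^ 4 * (1 / (p : ℝ) ^ 2) + 2 * n * N ^ 2 := by
      field_simp
    rw [e] at h6
    have e1 : Real.log p * (n * N ^ 4 / p) = n * N ^ 4 * (Real.log p / p) := by ring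
    have e2 : Real.log p / (p : ℝ) ^ 2 = Real.log p * (1 / (p : ℝ) ^ 2) := by ring
    rw [e1] at h6
    rw [e2]
    linarith
  have hsum := (Finset.sum_le_sum hlower).trans hupper
  rw [Finset.sum_sub_distrib, Finset.sum_sub_distrib, ← Finset.mul_sum, ← Finset.mul_sum,
    ← Finset.mul_sum] at hsum
  have hlogp : ∀ p ∈ Nat.primesLE (N ^ 2), 0 ≤ Real.log p := fun p hp =>
    Real.log_nonneg (by exact_mod_cast (Nat.mem_primesLE.mp hp).2.one_le)
  -- Discarding the primes that divide D costs at most log |D|.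
  have hS1 : Real.log ((N ^ 2 : ℕ) : ℝ) - c₁ - Real.log |(D : ℝ)| ≤ ∑ p ∈ P, Real.log p / p := by
    have h1 := hc₁ (N ^ 2) (by positivity)
    rw [← Finset.sum_filter_not_add_sum_filter _ (fun p : ℕ => (p : ℤ) ∣ D)] at h1
    have h2 : ∑ p ∈ (Nat.primesLE (N ^ 2)).filter (fun p : ℕ => (p : ℤ) ∣ D), Real.log p / p
        ≤ Real.log |(D : ℝ)| := by
      refine (Finset.sum_le_sum fun p hp => ?_).trans (Int.sum_log_primes_dvd_le hD
        (Nat.primesLE (N ^ 2)) fun p hp => (Nat.mem_primesLE.mp hp).2)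
      have hp' := (Finset.mem_filter.mp hp).1
      exact div_le_self (hlogp p hp') (by exact_mod_cast (Nat.mem_primesLE.mp hp').2.one_le)
    linarith
  have hS2 : ∑ p ∈ P, Real.log p ≤ Real.log 4 * N ^ 2 := by
    refine (Finset.sum_le_sum_of_subset_of_nonneg (Finset.filter_subset _ _)
      fun p hp _ => hlogp p hp).trans ?_
    rw [← Chebyshev.theta_eq_sum_primesLE_log]
    refine (Chebyshev.theta_le_log4_mul_x (by positivity)).trans (le_of_eq (by push_cast; ring))
  have hS3 := hc₂ P
  have hlog : Real.log ((N ^ 2 : ℕ) : ℝ) = 2 * Real.log N := by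
    rw [Nat.cast_pow, Real.log_pow]; norm_num
  rw [hlog] at hS1
  have hN4 : (0 : ℝ) < N ^ 4 := by positivity
  have t1 : n * N ^ 4 * (2 * Real.log N - c₁ - Real.log |(D : ℝ)|)
      ≤ n * N ^ 4 * ∑ p ∈ P, Real.log p / p := mul_le_mul_of_nonneg_left hS1 (by positivity)
  have t2 : (2 * n + 1) * N ^ 2 * ∑ p ∈ P, Real.log p
      ≤ (2 * n + 1) * N ^ 2 * (Real.log 4 * N ^ 2) := mul_le_mul_of_nonneg_left hS2 (by positivity)
  have t3 : 2 * n * N ^ 4 * ∑ p ∈ P, Real.log p / (p : ℝ) ^ 2 ≤ 2 * n * N ^ 4 * c₂ :=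
    mul_le_mul_of_nonneg_left hS3 (by positivity)
  have hfin : (N : ℝ) ^ 4 * (n * Real.log N) ≤ N ^ 4 * K := by
    rw [hK]
    nlinarith
  exact absurd (le_of_mul_le_mul_left hfin hN4) (not_le.mpr hNK)

end Polynomial

/-! ### Rationally irreducible actions on lattices. -/

section RationallyIrreducible

open Polynomial

/-- Otherwise f and Q are coprime over ℚ, and a cleared Bézout relation yields a nonzero integer
annihilating the nonzero torsion-free group A. -/
theorem Polynomial.dvd_of_aeval_eq_zero_of_irreducible {A : Type*} [AddCommGroup A]
    [Nontrivial A] [Module.IsTorsionFree ℤ A]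
    {T : Module.End ℤ A} {f Q : ℤ[X]}
    (hm : f.Monic) (hf : Irreducible f) (hfT : aeval T f = 0) (hQ : aeval T Q = 0) : f ∣ Q := by
  rw [IsPrimitive.Int.dvd_iff_map_cast_dvd_map_cast _ _ hm.isPrimitive]
  by_contra hdvd
  have hq := (hm.irreducible_iff_irreducible_map_fraction_map (K := ℚ)).mp hf
  obtain ⟨u, v, D, hD, h⟩ := exists_mul_add_mul_eq_C (f := f) (g := Q)
    ((hq.coprime_iff_not_dvd).mpr hdvd)
  have h1 := congrArg (aeval T) h
  rw [map_add, map_mul, map_mul, hfT, hQ, mul_zero, mul_zero, add_zero, aeval_C] at h1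
  obtain ⟨a, ha⟩ := exists_ne (0 : A)
  have h2 := LinearMap.congr_fun h1 a
  rw [LinearMap.zero_apply, Module.algebraMap_end_apply] at h2
  exact (smul_ne_zero hD ha) h2.symm

variable {A G : Type*} [AddCommGroup A] [Monoid G]

/-- Scalars commute, so every commutator maps A into L, for each p. If the invariant submodule W
spanned by commutator images were nonzero it would contain kA; for a prime p > k the submodule L
would contain both pA and kA, hence A. -/
theorem commute_of_forall_prime_exists_submodule (ρ : G →* Module.End ℤ A)
    (hirr : ∀ W : Submodule ℤ A, (∀ g, ∀ w ∈ W, ρ g w ∈ W) → W ≠ ⊥ →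
      ∃ k : ℕ, 0 < k ∧ ∀ a : A, (k : ℤ) • a ∈ W)
    (htop : ∀ p : ℕ, p.Prime → ∃ L : Submodule ℤ A, (∀ a : A, (p : ℤ) • a ∈ L) ∧ L ≠ ⊤ ∧
      ∀ g, ∃ c : ℤ, ∀ a, ρ g a - c • a ∈ L) (g h : G) : Commute (ρ g) (ρ h) := by
  by_contra hgh
  let W : Submodule ℤ A := Submodule.span ℤ
    {w | ∃ (x : G) (a : A), w = ρ x (ρ g (ρ h a) - ρ h (ρ g a))}
  have hW1 : ∀ g, ∀ w ∈ W, ρ g w ∈ W := by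
    intro y w hw
    induction hw using Submodule.span_induction with
    | mem w hw =>
      obtain ⟨x, a, rfl⟩ := hw
      exact Submodule.subset_span ⟨y * x, a, by rw [map_mul, Module.End.mul_apply]⟩
    | zero => rw [map_zero]; exact W.zero_mem
    | add u v _ _ hu hv => rw [map_add]; exact W.add_mem hu hv
    | smul c u _ hu => rw [map_smul]; exact W.smul_mem c hu
  have hW2 : W ≠ ⊥ := by
    intro h0
    apply hgh
    refine LinearMap.ext fun a => ?_
    have : ρ 1 (ρ g (ρ h a) - ρ h (ρ g a)) ∈ W := Submodule.subset_span ⟨1, a, rfl⟩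
    rw [h0, Submodule.mem_bot, map_one, Module.End.one_apply, sub_eq_zero] at this
    exact this
  obtain ⟨k, hk, hkW⟩ := hirr W hW1 hW2
  obtain ⟨p, hpk, hp⟩ := Nat.exists_infinite_primes (k + 1)
  obtain ⟨L, hpL, hL, hLg⟩ := htop p hp
  have hinv : ∀ x, ∀ l ∈ L, ρ x l ∈ L := by
    intro x l hl
    obtain ⟨c, hc⟩ := hLg x
    have := L.add_mem (hc l) (L.smul_mem c hl)
    rwa [sub_add_cancel] at this
  have hWL : W ≤ L := by
    refine Submodule.span_le.mpr ?_
    rintro _ ⟨x, a, rfl⟩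
    refine hinv x _ ?_
    obtain ⟨c, hc⟩ := hLg g
    obtain ⟨d, hd⟩ := hLg h
    have h1 := L.add_mem (hc (ρ h a)) (L.smul_mem c (hd a))
    have h2 := L.add_mem (hd (ρ g a)) (L.smul_mem d (hc a))
    have h3 := L.sub_mem h1 h2
    rw [smul_sub, smul_sub, sub_add_sub_cancel, sub_add_sub_cancel, smul_comm d c,
      sub_sub_sub_cancel_right] at h3
    exact h3
  apply hL
  rw [eq_top_iff]
  intro a _
  have hcop : IsCoprime (p : ℤ) (k : ℤ) := by
    rw [Nat.isCoprime_iff_coprime]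
    exact (Nat.Prime.coprime_iff_not_dvd hp).mpr fun hd => by
      have := Nat.le_of_dvd hk hd; omega
  obtain ⟨u, v, huv⟩ := hcop
  have := L.add_mem (L.smul_mem u (hpL a)) (L.smul_mem v (hWL (hkW a)))
  rwa [smul_smul, smul_smul, ← add_smul, huv, one_smul] at this

variable [Module.Finite ℤ A] [Nontrivial A]

/-- In a proper factorization g₁g₂ the range of g₂(T) contains some kA. As g₁(T) kills that range
and A is torsion-free, g₁(T) = 0, against minimality. -/
theorem minpoly_irreducible_of_rationally_irreducible [Module.IsTorsionFree ℤ A]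
    (T : Module.End ℤ A)
    (hirr : ∀ g : ℤ[X], aeval T g ≠ 0 → ∃ k : ℕ, 0 < k ∧
      ∀ a : A, (k : ℤ) • a ∈ LinearMap.range (aeval T g)) :
    Irreducible (minpoly ℤ T) := by
  have hint : IsIntegral ℤ T := Algebra.IsIntegral.isIntegral T
  have hmon := minpoly.monic hint
  have hmin : ∀ g : ℤ[X], g.Monic → g.natDegree < (minpoly ℤ T).natDegree → aeval T g ≠ 0 := by
    intro g hg hlt h0
    have := natDegree_le_natDegree (minpoly.min ℤ T hg h0)
    omega
  rw [hmon.irreducible_iff_natDegree']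
  refine ⟨fun h1 => ?_, fun g₁ g₂ hg₁ hg₂ hmul hdeg => ?_⟩
  · have h2 := minpoly.aeval ℤ T
    rw [h1, map_one] at h2
    exact one_ne_zero h2
  · rw [Finset.mem_Ioc] at hdeg
    have hd := congrArg natDegree hmul
    rw [hg₁.natDegree_mul hg₂] at hd
    obtain ⟨k, hk, hkr⟩ := hirr g₂ (hmin g₂ hg₂ (by omega))
    apply hmin g₁ hg₁ (by omega)
    refine LinearMap.ext fun a => ?_
    obtain ⟨b, hb⟩ := hkr a
    have h0 : aeval T g₁ (aeval T g₂ b) = 0 := by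
      rw [← Module.End.mul_apply, ← map_mul, hmul, minpoly.aeval, LinearMap.zero_apply]
    rw [hb, map_smul, smul_eq_zero] at h0
    exact h0.resolve_left (by exact_mod_cast hk.ne')

/-- Since q(T) maps A into pA, Cayley–Hamilton gives a monic Q, with all lower coefficients
divisible by p, that annihilates q(T). Then f divides Q ∘ q, which modulo p is a power of q. -/
theorem Polynomial.splits_map_of_range_aeval_le [Module.IsTorsionFree ℤ A]
    {T : Module.End ℤ A} {f q : ℤ[X]}
    (hm : f.Monic) (hf : Irreducible f) (hfT : aeval T f = 0) {p : ℕ} [Fact p.Prime]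
    (hq : q.Monic) (hqs : q.Splits) (hqT : ∀ a, ∃ b, aeval T q a = (p : ℤ) • b) :
    (f.map (Int.castRingHom (ZMod p))).Splits := by
  obtain ⟨Q, hQm, -, hQc, hQ⟩ :=
    LinearMap.exists_monic_and_natDegree_eq_and_coeff_mem_pow_and_aeval_eq_zero
      _ (aeval T q) (Ideal.span {(p : ℤ)}) (by
        rintro _ ⟨a, rfl⟩
        obtain ⟨b, hb⟩ := hqT a
        rw [hb]
        exact Submodule.smul_mem_smul (Ideal.mem_span_singleton_self _) trivial)
  have hdvd : f ∣ Q.comp q :=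
    dvd_of_aeval_eq_zero_of_irreducible hm hf hfT (by rw [aeval_comp, hQ])
  have hmap : Q.map (Int.castRingHom (ZMod p)) = X ^ Q.natDegree := by
    ext k
    rw [coeff_map, coeff_X_pow]
    rcases lt_trichotomy k Q.natDegree with hk | hk | hk
    · rw [if_neg hk.ne, eq_intCast, ZMod.intCast_zmod_eq_zero_iff_dvd]
      exact Ideal.mem_span_singleton.mp (Ideal.pow_le_self (by omega) (hQc k))
    · rw [if_pos hk, hk, hQm.coeff_natDegree, map_one]
    · rw [if_neg hk.ne', coeff_eq_zero_of_natDegree_lt hk, map_zero]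
  have hd := Polynomial.map_dvd (Int.castRingHom (ZMod p)) hdvd
  rw [map_comp, hmap, X_pow_comp] at hd
  exact ((hqs.map _).pow _).of_dvd (pow_ne_zero _ (hq.map _).ne_zero) hd

/-- A monoid acting rationally irreducibly on a lattice, and triangularly modulo every prime,
acts by scalars. -/
theorem exists_forall_eq_zsmul_of_triangular_mod_primes [Module.IsTorsionFree ℤ A]
    (ρ : G →* Module.End ℤ A)
    (hirr : ∀ W : Submodule ℤ A, (∀ g, ∀ w ∈ W, ρ g w ∈ W) → W ≠ ⊥ →
      ∃ k : ℕ, 0 < k ∧ ∀ a : A, (k : ℤ) • a ∈ W)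
    (htop : ∀ p : ℕ, p.Prime → ∃ L : Submodule ℤ A, (∀ a : A, (p : ℤ) • a ∈ L) ∧ L ≠ ⊤ ∧
      ∀ g, ∃ c : ℤ, ∀ a, ρ g a - c • a ∈ L)
    (hsplit : ∀ p : ℕ, p.Prime → ∀ g, ∃ q : ℤ[X], q.Monic ∧ q.Splits ∧
      ∀ a, ∃ b, aeval (ρ g) q a = (p : ℤ) • b) (g : G) :
    ∃ c : ℤ, ∀ a, ρ g a = c • a := by
  have hcomm := commute_of_forall_prime_exists_submodule ρ hirr htop
  set T := ρ g with hT
  -- Commutativity makes the range of q(T) invariant, so rational irreducibility applies to it.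
  have hf := minpoly_irreducible_of_rationally_irreducible T (fun q hq0 => by
    refine hirr _ ?_ (by rwa [Ne, LinearMap.range_eq_bot])
    rintro x _ ⟨a, rfl⟩
    have hc : Commute (ρ x) (aeval T q) := by
      refine Polynomial.induction_on (motive := fun q => Commute (ρ x) (aeval T q)) q ?_ ?_ ?_
      · intro c; rw [aeval_C]; exact (Algebra.commutes c (ρ x)).symm
      · intro u v hu hv; rw [map_add]; exact hu.add_right hv
      · intro n c _
        rw [map_mul, aeval_C, map_pow, aeval_X]
        exact (show Commute (ρ x) _ from (Algebra.commutes c (ρ x)).symm).mul_right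
          ((hcomm x g).pow_right _)
    exact ⟨ρ x a, (LinearMap.congr_fun hc a).symm⟩)
  have hm : (minpoly ℤ T).Monic := minpoly.monic (Algebra.IsIntegral.isIntegral T)
  have hdeg := natDegree_eq_one_of_forall_splits_map hm hf (fun p hp => by
    have := Fact.mk hp
    obtain ⟨q, hq, hqs, hqT⟩ := hsplit p hp g
    exact splits_map_of_range_aeval_le hm hf (minpoly.aeval ℤ T) hq hqs hqT)
  have h0 := minpoly.aeval ℤ T
  rw [hm.eq_X_add_C hdeg, map_add, aeval_X, aeval_C] at h0
  refine ⟨-(minpoly ℤ T).coeff 0, fun a => ?_⟩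
  have h1 := LinearMap.congr_fun h0 a
  rw [LinearMap.add_apply, Module.algebraMap_end_apply, LinearMap.zero_apply] at h1
  rw [neg_smul]
  exact eq_neg_of_add_eq_zero_left h1

end RationallyIrreducible

namespace SkewBrace

/-! ### The λ-action. -/

section Lambda

variable {B : Type*} [SkewBrace B]

theorem mul_eq_add_lam (a b : B) : a * b = a + lam a b := by
  rw [lam, add_neg_cancel_left]

/-- The map `λ_a` as an additive endomorphism. -/
def lamHom (a : B) : B →+ B where
  toFun := lam a
  map_zero' := by rw [lam, mul_zero_eq, neg_add_cancel]
  map_add' b c := by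
    simp only [lam, mul_add_eq, sub_eq_add_neg, add_assoc]

@[simp] theorem lamHom_apply (a b : B) : lamHom a b = lam a b := rfl

theorem lam_add (a b c : B) : lam a (b + c) = lam a b + lam a c := map_add (lamHom a) b c

theorem lam_zsmul (a : B) (k : ℤ) (b : B) : lam a (k • b) = k • lam a b :=
  map_zsmul (lamHom a) k b

theorem lam_one (b : B) : lam 1 b = b := by
  rw [lam, one_mul, one_eq_zero, neg_zero, zero_add]

theorem lam_mul (a b c : B) : lam (a * b) c = lam a (lam b c) := by
  have h : a * b + lam (a * b) c = a * b + lam a (lam b c) := by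
    rw [← mul_eq_add_lam, mul_assoc, mul_eq_add_lam b c, mul_add_eq, sub_eq_add_neg, add_assoc]
    rfl
  exact add_left_cancel h

theorem lam_inv_lam (a b : B) : lam a⁻¹ (lam a b) = b := by
  rw [← lam_mul, inv_mul_cancel, lam_one]

theorem lam_lam_inv (a b : B) : lam a (lam a⁻¹ b) = b := by
  rw [← lam_mul, mul_inv_cancel, lam_one]

theorem inv_eq_neg_lam_inv (a : B) : a⁻¹ = -lam a⁻¹ a := by
  rw [eq_neg_iff_add_eq_zero, ← mul_eq_add_lam, inv_mul_cancel, one_eq_zero]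

theorem lam_mem_center (a : B) {b : B} (hb : b ∈ AddSubgroup.center B) :
    lam a b ∈ AddSubgroup.center B := by
  rw [AddSubgroup.mem_center_iff] at hb ⊢
  intro g
  rw [← lam_lam_inv a g, ← lam_add, ← lam_add, hb]

end Lambda

/-! ### Ideals, the socle, and the steps of chains. -/

section Ideals

variable {B : Type*} [SkewBrace B]

instance : AddSubgroupClass (Ideal B) B where
  add_mem {I} _ _ ha hb := I.toAddSubgroup.add_mem ha hb
  zero_mem I := I.toAddSubgroup.zero_mem
  neg_mem {I} _ ha := I.toAddSubgroup.neg_mem ha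

theorem Ideal.mul_mem (I : Ideal B) {a b : B} (ha : a ∈ I) (hb : b ∈ I) : a * b ∈ I :=
  I.mul_mem' ha hb

theorem Ideal.lam_mem (I : Ideal B) (b : B) {a : B} (ha : a ∈ I) : lam b a ∈ I :=
  I.lam_mem' b ha

theorem Ideal.add_conj_mem (I : Ideal B) (b : B) {a : B} (ha : a ∈ I) : b + a + -b ∈ I :=
  I.add_conj_mem' b ha

theorem Ideal.mul_conj_mem (I : Ideal B) (b : B) {a : B} (ha : a ∈ I) : b * a * b⁻¹ ∈ I :=
  I.mul_conj_mem' b ha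

instance : Bot (Ideal B) where
  bot :=
    { (⊥ : AddSubgroup B) with
      mul_mem' := by
        intro a b (ha : a = 0) (hb : b = 0)
        exact (show a * b = 0 by rw [hb, mul_zero_eq, ha])
      inv_mem' := by
        intro a (ha : a = 0)
        exact (show a⁻¹ = 0 by rw [ha, ← one_eq_zero, inv_one])
      lam_mem' := by
        intro b a (ha : a = 0)
        exact (show lam b a = 0 by rw [ha, ← lamHom_apply, map_zero])
      add_conj_mem' := by
        intro b a (ha : a = 0)
        exact (show b + a + -b = 0 by rw [ha, add_zero, add_neg_cancel])
      mul_conj_mem' := by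
        intro b a (ha : a = 0)
        exact (show b * a * b⁻¹ = 0 by rw [ha, mul_zero_eq, mul_inv_cancel, one_eq_zero]) }

instance : Top (Ideal B) where
  top :=
    { (⊤ : AddSubgroup B) with
      mul_mem' := fun _ _ => trivial
      inv_mem' := fun _ => trivial
      lam_mem' := fun _ _ _ => trivial
      add_conj_mem' := fun _ _ _ => trivial
      mul_conj_mem' := fun _ _ _ => trivial }

@[simp] theorem Ideal.mem_bot {a : B} : a ∈ (⊥ : Ideal B) ↔ a = 0 := Iff.rfl

@[simp] theorem Ideal.mem_top (a : B) : a ∈ (⊤ : Ideal B) := trivial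

theorem Ideal.ext {I J : Ideal B} (h : ∀ a, a ∈ I ↔ a ∈ J) : I = J := SetLike.ext h

theorem Ideal.eq_bot_iff {I : Ideal B} : I = ⊥ ↔ ∀ a ∈ I, a = 0 := by
  refine ⟨fun h a ha => by rwa [h] at ha, fun h => Ideal.ext fun a => ⟨h a, ?_⟩⟩
  intro ha
  rw [Ideal.mem_bot.mp ha]
  exact zero_mem I

/-- `J` lies in the socle modulo `I`. -/
def SocleMod (I J : Ideal B) : Prop :=
  ∀ a ∈ J, ∀ b : B, -b + lam a b ∈ I ∧ -(a + b) + (b + a) ∈ I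

/-- Additive subgroups between `I` and `J` which are invariant under all `λ_b` are ideals, provided
that `J` lies in the socle modulo `I`. -/
def Ideal.ofSocleMod {I J : Ideal B} (h : SocleMod I J) (H : AddSubgroup B)
    (hIH : ∀ a ∈ I, a ∈ H) (hHJ : ∀ a ∈ H, a ∈ J) (hlam : ∀ b : B, ∀ a ∈ H, lam b a ∈ H) :
    Ideal B :=
  have hmul : ∀ {a b : B}, a ∈ H → b ∈ H → a * b ∈ H := fun {a b} ha hb => by
    rw [mul_eq_add_lam]
    exact H.add_mem ha (hlam a b hb)
  { H with
    mul_mem' := hmul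
    inv_mem' := by
      intro a ha
      rw [inv_eq_neg_lam_inv]
      exact H.neg_mem (hlam _ _ ha)
    lam_mem' := fun b a ha => hlam b a ha
    add_conj_mem' := by
      intro b a ha
      -- Modulo I the element a is additively central, so conjugation alters it only by an element
      -- of I.
      have h1 := I.add_conj_mem b (h a (hHJ a ha) b).2
      have h2 : b + a + -b = a + (b + (-(a + b) + (b + a)) + -b) := by
        simp only [neg_add_rev, add_assoc, add_neg_cancel_left]
      show b + a + -b ∈ H
      rw [h2]
      exact H.add_mem ha (hIH _ h1)
    mul_conj_mem' := by
      intro b a ha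
      show b * a * b⁻¹ ∈ H
      -- With c = λ_b(a), modulo I one has c·b = c + b = b + c = b·a, so b a b⁻¹ agrees with c.
      have hc : lam b a ∈ H := hlam b a ha
      obtain ⟨h1, h2⟩ := h _ (hHJ _ hc) b
      set c := lam b a with hc_def
      have h3 : -(c * b) + b * a ∈ I := by
        have e : -(c * b) + b * a
            = -(-b + lam c b) + (-(c + b) + (b + c)) := by
          rw [mul_eq_add_lam c b, mul_eq_add_lam b a, ← hc_def]
          simp only [neg_add_rev, neg_neg, add_assoc, add_neg_cancel_left]
        rw [e]
        exact add_mem (neg_mem h1) h2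
      have h4 : (c * b)⁻¹ * (b * a) ∈ I := (I.inv_mul_mem_iff _ _).mpr h3
      have h5 := I.mul_conj_mem b h4
      have h6 : b * a * b⁻¹ = c * (b * ((c * b)⁻¹ * (b * a)) * b⁻¹) := by group
      rw [h6]
      exact hmul hc (hIH _ h5) }

/-- The conjugate also has trivial λ, so multiplying it by b is adding b; centrality of λ_b(a) does
the rest. -/
theorem conj_eq_lam_of_mem_socle (b : B) {a : B} (ha : a ∈ socle B) : b * a * b⁻¹ = lam b a := by
  have hlam : ∀ x, lam (b * a * b⁻¹) x = x := fun x => by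
    rw [lam_mul, lam_mul, ha.1, lam_lam_inv]
  apply add_right_cancel (b := b)
  calc b * a * b⁻¹ + b = b * a * b⁻¹ * b := by rw [mul_eq_add_lam (b * a * b⁻¹) b, hlam]
    _ = b + lam b a := by rw [inv_mul_cancel_right, mul_eq_add_lam]
    _ = lam b a + b := AddSubgroup.mem_center_iff.mp (lam_mem_center b ha.2) b

/-- The socle as an ideal. -/
def socleIdeal (B : Type*) [SkewBrace B] : Ideal B :=
  have hmul : ∀ {a b : B}, a ∈ socle B → b ∈ socle B → a * b ∈ socle B := fun {a b} ha hb => by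
    refine ⟨fun x => by rw [lam_mul, hb.1, ha.1], ?_⟩
    rw [mul_eq_add_lam, ha.1]
    exact add_mem ha.2 hb.2
  have hinv : ∀ {a : B}, a ∈ socle B → a⁻¹ = -a := fun {a} ha => by
    rw [eq_neg_iff_add_eq_zero, AddSubgroup.mem_center_iff.mp ha.2, ← ha.1 a⁻¹, ← mul_eq_add_lam,
      mul_inv_cancel, one_eq_zero]
  have hinv_mem : ∀ {a : B}, a ∈ socle B → a⁻¹ ∈ socle B := fun {a} ha => by
    refine ⟨fun x => by rw [← ha.1 (lam a⁻¹ x), lam_lam_inv], ?_⟩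
    rw [hinv ha]
    exact neg_mem ha.2
  have hlam : ∀ (b : B) {a : B}, a ∈ socle B → lam b a ∈ socle B := fun b {a} ha => by
    refine ⟨fun x => ?_, lam_mem_center b ha.2⟩
    rw [← conj_eq_lam_of_mem_socle b ha, lam_mul, lam_mul, ha.1, lam_lam_inv]
  { carrier := socle B
    zero_mem' := ⟨fun b => by rw [← one_eq_zero, lam_one], zero_mem _⟩
    add_mem' := fun {a b} ha hb => by
      have : a + b = a * b := by rw [mul_eq_add_lam, ha.1]
      rw [this]
      exact hmul ha hb
    neg_mem' := fun {a} ha => by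
      rw [← hinv ha]
      exact hinv_mem ha
    mul_mem' := hmul
    inv_mem' := hinv_mem
    lam_mem' := fun b _ ha => hlam b ha
    add_conj_mem' := fun b a ha => by
      rw [AddSubgroup.mem_center_iff.mp ha.2 b, add_neg_cancel_right]
      exact ha
    mul_conj_mem' := fun b a ha => by
      rw [conj_eq_lam_of_mem_socle b ha]
      exact hlam b ha }

theorem mem_socleIdeal {a : B} : a ∈ socleIdeal B ↔ a ∈ socle B := Iff.rfl

theorem socleMod_bot_socleIdeal : SocleMod (⊥ : Ideal B) (socleIdeal B) := by
  intro a ha b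
  rw [mem_socleIdeal] at ha
  rw [ha.1, AddSubgroup.mem_center_iff.mp ha.2 b]
  simp

/-- One step of a chain witnessing supersolubility: `J / I` is generated by a single element, and
either is infinite and contained in the socle, or has prime order. -/
def SupersolubleStep (I J : Ideal B) : Prop :=
  (∀ a ∈ I, a ∈ J) ∧ ∃ x ∈ J, ∃ n : ℕ, (∀ y ∈ J, ∃ k : ℤ, -(k • x) + y ∈ I) ∧
    (∀ k : ℤ, k • x ∈ I ↔ (n : ℤ) ∣ k) ∧ (n = 0 ∧ SocleMod I J ∨ n.Prime)

/-- One step of a chain witnessing almost polycyclicity. -/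
def PolycyclicStep (I J : Ideal B) : Prop :=
  (∀ a ∈ I, a ∈ J) ∧ ∃ E : Set B, E.Finite ∧ (∀ e ∈ E, e ∈ J) ∧
    (SocleMod I J ∧ (∀ a ∈ J, ∃ s ∈ AddSubgroup.closure E, -s + a ∈ I) ∨
      ∀ a ∈ J, ∃ e ∈ E, -e + a ∈ I)

end Ideals

/-! ### Chains of ideals as reachability relations. -/

section Chains

theorem exists_chain_iff_reflTransGen {α : Type*} {r : α → α → Prop} {a b : α} :
    (∃ (n : ℕ) (f : ℕ → α), f 0 = a ∧ f n = b ∧ ∀ i < n, r (f i) (f (i + 1))) ↔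
      Relation.ReflTransGen r a b := by
  constructor
  · rintro ⟨n, f, rfl, rfl, h⟩
    induction n with
    | zero => exact .refl
    | succ n ih => exact (ih fun i hi => h i (by omega)).tail (h n (by omega))
  · intro h
    induction h using Relation.ReflTransGen.head_induction_on with
    | refl => exact ⟨0, fun _ => b, rfl, rfl, by simp⟩
    | @head a c hac _ ih =>
      obtain ⟨n, f, h0, hn, hf⟩ := ih
      refine ⟨n + 1, fun i => Nat.casesOn i a f, rfl, hn, fun i hi => ?_⟩
      cases i with
      | zero => simpa [h0] using hac
      | succ i => exact hf i (by omega)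

variable {B : Type*} [SkewBrace B]

theorem Ideal.toQuot_eq_iff (I : Ideal B) {a b : B} : I.toQuot a = I.toQuot b ↔ -a + b ∈ I :=
  QuotientAddGroup.eq

theorem Ideal.toQuot_eq_zero_iff (I : Ideal B) {a : B} : I.toQuot a = 0 ↔ a ∈ I :=
  QuotientAddGroup.eq_zero_iff a

theorem factor_subset_socle_iff (I J : Ideal B) :
    (I.factor J : Set I.Quot) ⊆ socle I.Quot ↔ SocleMod I J := by
  constructor
  · intro h a ha b
    obtain ⟨h1, h2⟩ := h (show I.toQuot a ∈ (I.factor J : Set I.Quot) from ⟨a, ha, rfl⟩)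
    exact ⟨I.toQuot_eq_iff.mp (h1 (I.toQuot b)).symm,
      I.toQuot_eq_iff.mp (AddSubgroup.mem_center_iff.mp h2 (I.toQuot b)).symm⟩
  · rintro h _ ⟨a, ha, rfl⟩
    refine ⟨?_, AddSubgroup.mem_center_iff.mpr ?_⟩
    · rintro ⟨b⟩
      exact (I.toQuot_eq_iff.mpr (h a ha b).1).symm
    · rintro ⟨b⟩
      exact (I.toQuot_eq_iff.mpr (h a ha b).2).symm

theorem factor_eq_zmultiples_iff (I J : Ideal B) {x : B} (hx : x ∈ J) :
    (I.factor J).toAddSubgroup = AddSubgroup.zmultiples (I.toQuot x) ↔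
      ∀ y ∈ J, ∃ k : ℤ, -(k • x) + y ∈ I := by
  constructor
  · intro h y hy
    have h1 : I.toQuot y ∈ (I.factor J).toAddSubgroup := ⟨y, hy, rfl⟩
    rw [h] at h1
    obtain ⟨k, hk⟩ := AddSubgroup.mem_zmultiples_iff.mp h1
    exact ⟨k, I.toQuot_eq_iff.mp hk⟩
  · intro h
    apply le_antisymm
    · rintro _ ⟨y, hy, rfl⟩
      obtain ⟨k, hk⟩ := h y hy
      exact AddSubgroup.mem_zmultiples_iff.mpr ⟨k, I.toQuot_eq_iff.mpr hk⟩
    · rw [AddSubgroup.zmultiples_le]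
      exact ⟨x, hx, rfl⟩

theorem zsmul_mem_iff_addOrderOf_dvd (I : Ideal B) (x : B) (k : ℤ) :
    k • x ∈ I ↔ (addOrderOf (I.toQuot x) : ℤ) ∣ k := by
  rw [addOrderOf_dvd_iff_zsmul_eq_zero, ← I.toQuot_eq_zero_iff]
  rfl

/-- The integer n of a step is the additive order of the generator modulo I, with 0 for infinite
order, matching the convention of `Nat.card`. A factor of prime order is cyclic, so both cases have
a generator. -/
theorem supersolubleStep_iff (I J : Ideal B) :
    SupersolubleStep I J ↔ (I : Set B) ⊆ J ∧
      ((Infinite (I.factor J).toAddSubgroup ∧ IsAddCyclic (I.factor J).toAddSubgroup ∧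
          (I.factor J : Set I.Quot) ⊆ socle I.Quot) ∨ (Nat.card (I.factor J)).Prime) := by
  refine and_congr Iff.rfl ?_
  rw [factor_subset_socle_iff]
  constructor
  · rintro ⟨x, hx, n, hgen, hn, h⟩
    have hfac := (factor_eq_zmultiples_iff I J hx).mpr hgen
    have hord : addOrderOf (I.toQuot x) = n := by
      apply Nat.dvd_antisymm
      · exact_mod_cast (zsmul_mem_iff_addOrderOf_dvd I x n).mp ((hn n).mpr dvd_rfl)
      · exact_mod_cast (hn _).mp ((zsmul_mem_iff_addOrderOf_dvd I x _).mpr dvd_rfl)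
    have hcard : Nat.card (I.factor J).toAddSubgroup = n := by
      rw [hfac, Nat.card_zmultiples, hord]
    rcases h with ⟨rfl, hsoc⟩ | hp
    · refine Or.inl ⟨?_, ?_, hsoc⟩
      · exact (Nat.card_eq_zero.mp hcard).resolve_left fun he => he.false 0
      · rw [hfac]
        infer_instance
    · right
      rw [← hcard] at hp
      exact hp
  · intro h
    have hcyc : IsAddCyclic (I.factor J).toAddSubgroup := by
      rcases h with h | h
      · exact h.2.1
      · have := Fact.mk h
        exact isAddCyclic_of_prime_card (p := Nat.card (I.factor J)) rfl
    obtain ⟨⟨_, x, hx, rfl⟩, hgen⟩ := hcyc.exists_zsmul_surjective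
    have hfac : (I.factor J).toAddSubgroup = AddSubgroup.zmultiples (I.toQuot x) := by
      apply le_antisymm
      · intro y hy
        obtain ⟨k, hk⟩ := hgen ⟨y, hy⟩
        exact AddSubgroup.mem_zmultiples_iff.mpr ⟨k, congrArg Subtype.val hk⟩
      · rw [AddSubgroup.zmultiples_le]
        exact ⟨x, hx, rfl⟩
    have hcard : Nat.card (I.factor J).toAddSubgroup = addOrderOf (I.toQuot x) := by
      rw [hfac, Nat.card_zmultiples]
    refine ⟨x, hx, addOrderOf (I.toQuot x), (factor_eq_zmultiples_iff I J hx).mp hfac,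
      zsmul_mem_iff_addOrderOf_dvd I x, ?_⟩
    rw [← hcard]
    rcases h with h | h
    · have := h.1
      exact Or.inl ⟨Nat.card_eq_zero_of_infinite, h.2.2⟩
    · exact Or.inr h

theorem Ideal.coe_eq_zero_iff {I : Ideal B} : (I : Set B) = {0} ↔ I = ⊥ :=
  ⟨fun h => SetLike.coe_injective h, fun h => by rw [h]; rfl⟩

theorem Ideal.coe_eq_univ_iff {I : Ideal B} : (I : Set B) = Set.univ ↔ I = ⊤ :=
  ⟨fun h => SetLike.coe_injective h, fun h => by rw [h]; rfl⟩

theorem isSupersoluble_iff :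
    IsSupersoluble B ↔ Relation.ReflTransGen SupersolubleStep (⊥ : Ideal B) ⊤ := by
  rw [← exists_chain_iff_reflTransGen, IsSupersoluble]
  simp only [supersolubleStep_iff, Ideal.coe_eq_zero_iff, Ideal.coe_eq_univ_iff]

/-- In the socle products are sums and inverses are negatives, so additive subgroups there are
subbraces and brace generators generate additively. -/
theorem closure_factor_of_fg {I J : Ideal B}
    (hsoc : (I.factor J : Set I.Quot) ⊆ socle I.Quot) (hfg : (I.factor J).FG) :
    ∃ E : Finset I.Quot, (E : Set I.Quot) ⊆ I.factor J ∧
      ∀ x ∈ I.factor J, x ∈ AddSubgroup.closure (E : Set I.Quot) := by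
  obtain ⟨E, hE, hmin⟩ := hfg
  refine ⟨E, hE, ?_⟩
  have hle : AddSubgroup.closure (E : Set I.Quot) ≤ (I.factor J).toAddSubgroup :=
    (AddSubgroup.closure_le _).mpr hE
  let T : Subbrace I.Quot :=
    { AddSubgroup.closure (E : Set I.Quot) with
      mul_mem' := by
        intro a b ha hb
        rw [mul_eq_add_lam, (hsoc (hle ha)).1]
        exact AddSubgroup.add_mem _ ha hb
      inv_mem' := by
        intro a ha
        have h : a + a⁻¹ = 0 := by
          rw [← (hsoc (hle ha)).1 a⁻¹, ← mul_eq_add_lam, mul_inv_cancel, one_eq_zero]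
        rw [← neg_eq_of_add_eq_zero_right h]
        exact AddSubgroup.neg_mem _ ha }
  exact hmin T AddSubgroup.subset_closure

theorem polycyclicStep_of_factor {I J : Ideal B} (hle : (I : Set B) ⊆ J)
    (h : ((I.factor J : Set I.Quot) ⊆ socle I.Quot ∧ (I.factor J).FG) ∨ Finite (I.factor J)) :
    PolycyclicStep I J := by
  classical
  refine ⟨hle, ?_⟩
  have hlift : ∀ S : Set I.Quot, S.Finite → S ⊆ I.factor J →
      ∃ E : Set B, E.Finite ∧ (∀ e ∈ E, e ∈ J) ∧ I.toQuot '' E = S := by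
    intro S hS hSJ
    obtain ⟨S, rfl⟩ := hS.exists_finset_coe
    obtain ⟨E, hEJ, hES⟩ := Finset.subset_set_image_iff.mp
      (show (S : Set I.Quot) ⊆ I.toQuot '' (J : Set B) from hSJ)
    exact ⟨E, E.finite_toSet, hEJ, by rw [← hES, Finset.coe_image]⟩
  rcases h with ⟨hsoc, hfg⟩ | hfin
  · obtain ⟨S, hSJ, hS⟩ := closure_factor_of_fg hsoc hfg
    obtain ⟨E, hEf, hEJ, hES⟩ := hlift S S.finite_toSet hSJ
    refine ⟨E, hEf, hEJ, Or.inl ⟨(factor_subset_socle_iff I J).mp hsoc, fun a ha => ?_⟩⟩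
    have h1 := hS (I.toQuot a) ⟨a, ha, rfl⟩
    rw [← hES] at h1
    have h2 := (AddMonoidHom.map_closure (QuotientAddGroup.mk' I.toAddSubgroup) E).ge h1
    obtain ⟨s, hs, hsa⟩ := h2
    exact ⟨s, hs, I.toQuot_eq_iff.mp hsa⟩
  · obtain ⟨E, hEf, hEJ, hES⟩ := hlift (I.factor J) hfin subset_rfl
    refine ⟨E, hEf, hEJ, Or.inr fun a ha => ?_⟩
    have h1 : I.toQuot a ∈ (I.factor J : Set I.Quot) := ⟨a, ha, rfl⟩
    rw [← hES] at h1
    obtain ⟨e, he, hea⟩ := h1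
    exact ⟨e, he, I.toQuot_eq_iff.mp hea⟩

theorem IsAlmostPolycyclic.reflTransGen (h : IsAlmostPolycyclic B) :
    Relation.ReflTransGen PolycyclicStep (⊥ : Ideal B) ⊤ := by
  obtain ⟨n, J, h0, hn, hJ⟩ := h
  rw [← exists_chain_iff_reflTransGen]
  exact ⟨n, J, Ideal.coe_eq_zero_iff.mp h0, Ideal.coe_eq_univ_iff.mp hn,
    fun i hi => polycyclicStep_of_factor (hJ i hi).1 (hJ i hi).2⟩

end Chains

end SkewBrace

namespace SkewBrace

/-! ### Cyclic factors. -/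

section Cyclic

variable {B : Type*} [SkewBrace B]

theorem Ideal.toQuot_lam (I : Ideal B) (a b : B) :
    I.toQuot (lam a b) = lam (I.toQuot a) (I.toQuot b) := rfl

theorem Ideal.toQuot_zsmul (I : Ideal B) (k : ℤ) (a : B) :
    I.toQuot (k • a) = k • I.toQuot a := rfl

/-- On a cyclic factor, every `λ_b` acts as multiplication by an integer. -/
theorem exists_lam_eq_zsmul_mod {I J : Ideal B} {x : B} (hx : x ∈ J)
    (hgen : ∀ y ∈ J, ∃ k : ℤ, -(k • x) + y ∈ I) (b : B) :
    ∃ c : ℤ, ∀ y ∈ J, -(c • y) + lam b y ∈ I := by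
  obtain ⟨c, hc⟩ := hgen _ (J.lam_mem b hx)
  refine ⟨c, fun y hy => ?_⟩
  obtain ⟨k, hk⟩ := hgen y hy
  rw [← I.toQuot_eq_iff, I.toQuot_zsmul] at hc hk ⊢
  rw [I.toQuot_lam, ← hk, lam_zsmul, ← I.toQuot_lam, ← hc, smul_smul, smul_smul, mul_comm]

theorem SocleMod.mono {I I' J : Ideal B} (h : SocleMod I J) (hI : ∀ a ∈ I, a ∈ I') :
    SocleMod I' J := fun a ha b => ⟨hI _ (h a ha b).1, hI _ (h a ha b).2⟩

theorem Ideal.eq_of_le_of_generator_mem {I J : Ideal B} (hIJ : ∀ a ∈ I, a ∈ J) {x : B}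
    (hgen : ∀ y ∈ J, ∃ k : ℤ, -(k • x) + y ∈ I) (hx : x ∈ I) : I = J := by
  refine Ideal.ext fun a => ⟨hIJ a, fun ha => ?_⟩
  obtain ⟨k, hk⟩ := hgen a ha
  have := add_mem (zsmul_mem hx k) hk
  rwa [add_neg_cancel_left] at this

/-- A finite cyclic factor in the socle can be refined to factors of prime order. -/
theorem reflTransGen_supersolubleStep_of_finite_cyclic {n : ℕ} (hn : 0 < n) {I J : Ideal B}
    (hIJ : ∀ a ∈ I, a ∈ J) (hsoc : SocleMod I J) {x : B} (hx : x ∈ J)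
    (hgen : ∀ y ∈ J, ∃ k : ℤ, -(k • x) + y ∈ I) (hord : ∀ k : ℤ, k • x ∈ I ↔ (n : ℤ) ∣ k) :
    Relation.ReflTransGen SupersolubleStep I J := by
  induction n using Nat.strong_induction_on generalizing I with
  | _ n ih =>
    by_cases hn1 : n = 1
    · have hxI : x ∈ I := by
        rw [← one_zsmul x, hord, hn1, Nat.cast_one]
      rw [Ideal.eq_of_le_of_generator_mem hIJ hgen hxI]
    obtain ⟨p, hp, m, rfl⟩ := Nat.exists_prime_and_dvd hn1
    have hm : 0 < m := Nat.pos_of_mul_pos_left hn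
    have hpm : m < p * m := by nlinarith [hp.two_le]
    -- Since x has order pm modulo I, the element mx has order p; it generates the next ideal over
    -- I, modulo which x has order m.
    let H : AddSubgroup B := (AddSubgroup.zmultiples (I.toQuot ((m : ℤ) • x))).comap
      (QuotientAddGroup.mk' I.toAddSubgroup)
    have hH : ∀ z, z ∈ H ↔ ∃ k : ℤ, k • (m : ℤ) • I.toQuot x = I.toQuot z := fun z =>
      AddSubgroup.mem_zmultiples_iff
    have hIH : ∀ a ∈ I, a ∈ H := fun a ha =>
      (hH a).mpr ⟨0, by rw [zero_smul]; exact (I.toQuot_eq_zero_iff.mpr ha).symm⟩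
    have hHJ : ∀ a ∈ H, a ∈ J := fun a ha => by
      obtain ⟨k, hk⟩ := (hH a).mp ha
      have h1 : -(k • (m : ℤ) • x) + a ∈ J := hIJ _ (I.toQuot_eq_iff.mp hk)
      have h2 := add_mem (zsmul_mem (zsmul_mem hx (m : ℤ)) k) h1
      rwa [add_neg_cancel_left] at h2
    let I' : Ideal B := Ideal.ofSocleMod hsoc H hIH hHJ (fun b a ha => by
      obtain ⟨k, hk⟩ := (hH a).mp ha
      obtain ⟨c, hc⟩ := hgen _ (J.lam_mem b hx)
      rw [← I.toQuot_eq_iff, I.toQuot_zsmul] at hc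
      refine (hH _).mpr ⟨k * c, ?_⟩
      rw [I.toQuot_lam, ← hk, lam_zsmul, lam_zsmul, ← I.toQuot_lam, ← hc]
      simp only [smul_smul]
      congr 1
      ring)
    have hI' : ∀ z, z ∈ I' ↔ ∃ k : ℤ, k • (m : ℤ) • I.toQuot x = I.toQuot z := hH
    have hm0 : (m : ℤ) ≠ 0 := by exact_mod_cast hm.ne'
    have hstep : SupersolubleStep I I' := by
      refine ⟨hIH, (m : ℤ) • x, (hI' _).mpr ⟨1, one_smul _ _⟩, p, ?_, ?_, Or.inr hp⟩
      · intro y hy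
        obtain ⟨k, hk⟩ := (hI' y).mp hy
        exact ⟨k, I.toQuot_eq_iff.mp hk⟩
      · intro k
        rw [smul_smul, hord, Nat.cast_mul]
        exact mul_dvd_mul_iff_right hm0
    refine .head hstep (ih m hpm hm hHJ (hsoc.mono hIH) ?_ ?_)
    · intro y hy
      obtain ⟨k, hk⟩ := hgen y hy
      exact ⟨k, hIH _ hk⟩
    · intro k
      rw [hI']
      constructor
      · rintro ⟨j, hj⟩
        rw [smul_smul, ← I.toQuot_zsmul, I.toQuot_eq_iff, ← neg_zsmul, ← add_zsmul, hord,
          Nat.cast_mul] at hj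
        have h1 : (m : ℤ) ∣ -(j * m) + k := (Dvd.intro_left _ rfl).trans hj
        exact (dvd_add_right (Dvd.intro_left _ (neg_mul _ _))).mp h1
      · rintro ⟨j, rfl⟩
        exact ⟨j, by rw [smul_smul, ← I.toQuot_zsmul, mul_comm]⟩

end Cyclic

/-! ### Transport of chains along homomorphisms. -/

namespace BraceHom

variable {B C : Type*} [SkewBrace B] [SkewBrace C] (f : BraceHom B C)

/-- The underlying additive homomorphism. -/
def addHom : B →+ C := AddMonoidHom.mk' f.toFun f.map_add'

/-- The underlying multiplicative homomorphism. -/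
def mulHom : B →* C := MonoidHom.mk' f.toFun f.map_mul'

theorem addHom_mul (a b : B) : f.addHom (a * b) = f.addHom a * f.addHom b := f.map_mul' a b

theorem addHom_inv (a : B) : f.addHom a⁻¹ = (f.addHom a)⁻¹ := map_inv f.mulHom a

theorem addHom_lam (a b : B) : f.addHom (lam a b) = lam (f.addHom a) (f.addHom b) := by
  rw [lam, map_add, map_neg, addHom_mul, lam]

/-- The preimage of an ideal. -/
def comap (I : Ideal C) : Ideal B :=
  { I.toAddSubgroup.comap f.addHom with
    mul_mem' := by
      intro a b ha hb
      show f.addHom (a * b) ∈ I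
      rw [addHom_mul]
      exact I.mul_mem ha hb
    inv_mem' := by
      intro a ha
      show f.addHom a⁻¹ ∈ I
      rw [addHom_inv]
      exact I.inv_mem' ha
    lam_mem' := by
      intro b a ha
      show f.addHom (lam b a) ∈ I
      rw [addHom_lam]
      exact I.lam_mem _ ha
    add_conj_mem' := by
      intro b a ha
      show f.addHom (b + a + -b) ∈ I
      rw [map_add, map_add, map_neg]
      exact I.add_conj_mem _ ha
    mul_conj_mem' := by
      intro b a ha
      show f.addHom (b * a * b⁻¹) ∈ I
      rw [addHom_mul, addHom_mul, addHom_inv]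
      exact I.mul_conj_mem _ ha }

theorem mem_comap {I : Ideal C} {b : B} : b ∈ f.comap I ↔ f.addHom b ∈ I := Iff.rfl

theorem comap_top : f.comap ⊤ = ⊤ := rfl

variable (hf : Function.Surjective f.addHom)

/-- The image of an ideal under a surjective homomorphism. -/
def map (I : Ideal B) : Ideal C :=
  { I.toAddSubgroup.map f.addHom with
    mul_mem' := by
      rintro _ _ ⟨a, ha, rfl⟩ ⟨b, hb, rfl⟩
      exact ⟨a * b, I.mul_mem ha hb, f.addHom_mul a b⟩
    inv_mem' := by
      rintro _ ⟨a, ha, rfl⟩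
      exact ⟨a⁻¹, I.inv_mem' ha, f.addHom_inv a⟩
    lam_mem' := by
      rintro c _ ⟨a, ha, rfl⟩
      obtain ⟨b, rfl⟩ := hf c
      exact ⟨lam b a, I.lam_mem b ha, f.addHom_lam b a⟩
    add_conj_mem' := by
      rintro c _ ⟨a, ha, rfl⟩
      obtain ⟨b, rfl⟩ := hf c
      exact ⟨b + a + -b, I.add_conj_mem b ha, by rw [map_add, map_add, map_neg]⟩
    mul_conj_mem' := by
      rintro c _ ⟨a, ha, rfl⟩
      obtain ⟨b, rfl⟩ := hf c
      exact ⟨b * a * b⁻¹, I.mul_conj_mem b ha, by rw [addHom_mul, addHom_mul, addHom_inv]⟩ }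

theorem addHom_mem_map {I : Ideal B} {a : B} (ha : a ∈ I) : f.addHom a ∈ f.map hf I :=
  ⟨a, ha, rfl⟩

theorem map_bot : f.map hf ⊥ = ⊥ := by
  rw [Ideal.eq_bot_iff]
  rintro _ ⟨a, ha, rfl⟩
  rw [show a = 0 from ha, map_zero]

theorem map_top : f.map hf ⊤ = ⊤ := by
  refine Ideal.ext fun c => ⟨fun _ => trivial, fun _ => ?_⟩
  obtain ⟨b, rfl⟩ := hf c
  exact ⟨b, trivial, rfl⟩

theorem comap_map {I : Ideal B} (h : ∀ a, f.addHom a = 0 → a ∈ I) : f.comap (f.map hf I) = I := by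
  refine Ideal.ext fun b => ⟨?_, fun hb => f.addHom_mem_map hf hb⟩
  rintro ⟨a, ha, hab⟩
  have h1 : -a + b ∈ I := h _ (by rw [map_add, map_neg, hab, neg_add_cancel])
  have h2 := add_mem (show a ∈ I from ha) h1
  rwa [add_neg_cancel_left] at h2

theorem supersolubleStep_comap_iff (hf : Function.Surjective f.addHom) {I J : Ideal C} :
    SupersolubleStep (f.comap I) (f.comap J) ↔ SupersolubleStep I J := by
  have hsoc : SocleMod (f.comap I) (f.comap J) ↔ SocleMod I J := by
    constructor
    · intro h a ha b
      obtain ⟨a, rfl⟩ := hf a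
      obtain ⟨b, rfl⟩ := hf b
      have := h a ha b
      simpa only [mem_comap, map_add, map_neg, addHom_lam] using this
    · intro h a ha b
      have := h _ ha (f.addHom b)
      simpa only [mem_comap, map_add, map_neg, addHom_lam] using this
  rw [SupersolubleStep, SupersolubleStep, hsoc]
  refine and_congr (hf.forall (p := fun c => c ∈ I → c ∈ J)).symm ⟨?_, ?_⟩
  · rintro ⟨x, hx, n, hgen, hord, h⟩
    refine ⟨f.addHom x, hx, n, ?_, ?_, h⟩
    · intro y hy
      obtain ⟨y, rfl⟩ := hf y
      obtain ⟨k, hk⟩ := hgen y hy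
      exact ⟨k, by simpa only [mem_comap, map_add, map_neg, map_zsmul] using hk⟩
    · intro k
      rw [← hord k, mem_comap, map_zsmul]
  · rintro ⟨x, hx, n, hgen, hord, h⟩
    obtain ⟨x, rfl⟩ := hf x
    refine ⟨x, hx, n, ?_, ?_, h⟩
    · intro y hy
      obtain ⟨k, hk⟩ := hgen _ hy
      exact ⟨k, by simpa only [mem_comap, map_add, map_neg, map_zsmul] using hk⟩
    · intro k
      rw [← hord k, mem_comap, map_zsmul]

/-- Every ideal of a chain starting above the kernel is the preimage of its image. -/
theorem reflTransGen_supersolubleStep_comap_iff (hf : Function.Surjective f.addHom) {I : Ideal C} :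
    Relation.ReflTransGen SupersolubleStep (f.comap I) ⊤ ↔
      Relation.ReflTransGen SupersolubleStep I ⊤ := by
  constructor
  · intro h
    have key : ∀ K : Ideal B, Relation.ReflTransGen SupersolubleStep K ⊤ →
        (∀ a, f.addHom a = 0 → a ∈ K) →
        Relation.ReflTransGen SupersolubleStep (f.map hf K) ⊤ := by
      intro K hK
      induction hK using Relation.ReflTransGen.head_induction_on with
      | refl => intro _; rw [map_top]
      | @head K K' hKK' _ ih =>
        intro hker
        have hker' : ∀ a, f.addHom a = 0 → a ∈ K' := fun a ha => hKK'.1 a (hker a ha)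
        refine .head ?_ (ih hker')
        rwa [← f.supersolubleStep_comap_iff hf, f.comap_map hf hker, f.comap_map hf hker']
    have hmc : f.map hf (f.comap I) = I := by
      refine Ideal.ext fun c => ⟨?_, fun hc => ?_⟩
      · rintro ⟨a, ha, rfl⟩
        exact ha
      · obtain ⟨b, rfl⟩ := hf c
        exact ⟨b, hc, rfl⟩
    rw [← hmc]
    exact key _ h fun a ha => by rw [mem_comap, ha]; exact zero_mem I
  · intro h
    rw [← f.comap_top]
    exact h.lift f.comap fun _ _ => (f.supersolubleStep_comap_iff hf).mpr

theorem socleMod_map {I J : Ideal B} (h : SocleMod I J) : SocleMod (f.map hf I) (f.map hf J) := by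
  rintro _ ⟨a, ha, rfl⟩ c
  obtain ⟨b, rfl⟩ := hf c
  exact ⟨⟨_, (h a ha b).1, by simp only [map_add, map_neg, addHom_lam]⟩,
    ⟨_, (h a ha b).2, by simp only [map_add, map_neg]⟩⟩

/-- The image factor is finite cyclic. It may need several prime steps if it comes from an infinite
factor, and may collapse if it comes from a prime one. -/
theorem reflTransGen_map_of_supersolubleStep [Finite C] {I J : Ideal B}
    (h : SupersolubleStep I J) :
    Relation.ReflTransGen SupersolubleStep (f.map hf I) (f.map hf J) := by
  obtain ⟨hIJ, x, hx, n, hgen, hord, h⟩ := h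
  have hle : ∀ c ∈ f.map hf I, c ∈ f.map hf J := by
    rintro _ ⟨a, ha, rfl⟩
    exact ⟨a, hIJ a ha, rfl⟩
  have hgen' : ∀ y ∈ f.map hf J, ∃ k : ℤ, -(k • f.addHom x) + y ∈ f.map hf I := by
    rintro _ ⟨y, hy, rfl⟩
    obtain ⟨k, hk⟩ := hgen y hy
    exact ⟨k, _, hk, by simp only [map_add, map_neg, map_zsmul]⟩
  have hord' := zsmul_mem_iff_addOrderOf_dvd (f.map hf I) (f.addHom x)
  set m := addOrderOf ((f.map hf I).toQuot (f.addHom x)) with hm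
  have hm0 : 0 < m := addOrderOf_pos _
  rcases h with ⟨-, hsoc⟩ | hp
  · exact reflTransGen_supersolubleStep_of_finite_cyclic hm0 hle (f.socleMod_map hf hsoc)
      (f.addHom_mem_map hf hx) hgen' hord'
  · have hmn : m ∣ n := by
      have h1 : (n : ℤ) • f.addHom x ∈ f.map hf I := by
        rw [← map_zsmul]
        exact f.addHom_mem_map hf ((hord n).mpr dvd_rfl)
      exact_mod_cast (hord' n).mp h1
    rcases (Nat.dvd_prime hp).mp hmn with h1 | h1
    · rw [Ideal.eq_of_le_of_generator_mem hle hgen' (by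
        rw [← one_zsmul (f.addHom x), hord', h1, Nat.cast_one])]
    · exact .single ⟨hle, f.addHom x, f.addHom_mem_map hf hx, n, hgen', by rwa [h1] at hord',
        Or.inr hp⟩

theorem isSupersoluble_of_finite (hf : Function.Surjective f.addHom) [Finite C]
    (h : IsSupersoluble B) : IsSupersoluble C := by
  rw [isSupersoluble_iff] at h ⊢
  rw [← f.map_bot hf, ← f.map_top hf]
  generalize (⊤ : Ideal B) = J at h
  induction h with
  | refl => exact .refl
  | tail _ hstep ih => exact ih.trans (f.reflTransGen_map_of_supersolubleStep hf hstep)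

theorem polycyclicStep_map {I J : Ideal B} (h : PolycyclicStep I J) :
    PolycyclicStep (f.map hf I) (f.map hf J) := by
  obtain ⟨hIJ, E, hE, hEJ, h⟩ := h
  refine ⟨?_, f.addHom '' E, hE.image _, ?_, ?_⟩
  · rintro _ ⟨a, ha, rfl⟩
    exact ⟨a, hIJ a ha, rfl⟩
  · rintro _ ⟨e, he, rfl⟩
    exact ⟨e, hEJ e he, rfl⟩
  · rcases h with ⟨hsoc, hgen⟩ | hfin
    · refine Or.inl ⟨f.socleMod_map hf hsoc, ?_⟩
      rintro _ ⟨a, ha, rfl⟩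
      obtain ⟨s, hs, hsa⟩ := hgen a ha
      refine ⟨f.addHom s, ?_, _, hsa, by rw [map_add, map_neg]⟩
      rw [← AddMonoidHom.map_closure]
      exact ⟨s, hs, rfl⟩
    · right
      rintro _ ⟨a, ha, rfl⟩
      obtain ⟨e, he, hea⟩ := hfin a ha
      exact ⟨_, ⟨e, he, rfl⟩, _, hea, by rw [map_add, map_neg]⟩

theorem reflTransGen_polycyclicStep (hf : Function.Surjective f.addHom)
    (h : Relation.ReflTransGen PolycyclicStep (⊥ : Ideal B) ⊤) :
    Relation.ReflTransGen PolycyclicStep (⊥ : Ideal C) ⊤ := by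
  rw [← f.map_bot hf, ← f.map_top hf]
  exact h.lift (f.map hf) fun _ _ => f.polycyclicStep_map hf

end BraceHom

/-- The quotient map as a homomorphism of braces. -/
def Ideal.quotHom {B : Type*} [SkewBrace B] (I : Ideal B) : BraceHom B I.Quot where
  toFun := I.toQuot
  map_add' := I.toQuot_add
  map_mul' := I.toQuot_mul

theorem Ideal.quotHom_surjective {B : Type*} [SkewBrace B] (I : Ideal B) :
    Function.Surjective I.quotHom.addHom := QuotientAddGroup.mk_surjective

theorem Ideal.comap_quotHom_bot {B : Type*} [SkewBrace B] (I : Ideal B) :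
    I.quotHom.comap ⊥ = I :=
  Ideal.ext fun _ => I.toQuot_eq_zero_iff

end SkewBrace

/-! ### Finite generation and pigeonhole. -/

section FinitelyGenerated

theorem AddSubgroup.fg_of_le_of_commute {Q : Type*} [AddGroup Q] {H K : AddSubgroup Q}
    (hcomm : ∀ a ∈ K, ∀ b ∈ K, a + b = b + a) (hK : K.FG) (hHK : H ≤ K) : H.FG := by
  let _ : AddCommGroup K :=
    { (inferInstance : AddGroup K) with
      add_comm := fun a b => Subtype.ext (hcomm a a.2 b b.2) }
  have hfin : Module.Finite ℤ K :=
    Module.Finite.iff_addGroup_fg.mpr ((AddGroup.fg_iff_addSubgroup_fg K).mpr hK)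
  have h1 : (AddSubgroup.toIntSubmodule (H.addSubgroupOf K)).FG := IsNoetherian.noetherian _
  rw [Submodule.fg_iff_addSubgroup_fg] at h1
  obtain ⟨E, hE⟩ := h1
  have hE' : AddSubgroup.closure (E : Set K) = H.addSubgroupOf K := hE
  refine (AddSubgroup.fg_iff H).mpr ⟨K.subtype '' E, ?_, E.finite_toSet.image _⟩
  rw [← AddMonoidHom.map_closure, hE', AddSubgroup.addSubgroupOf_map_subtype,
    inf_eq_left.mpr hHK]

theorem AddSubgroup.fg_of_fg_inf {G : Type*} [AddGroup G] {H N : AddSubgroup G}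
    (hN : (H ⊓ N).FG) {E : Set G} (hE : E.Finite) (hEH : E ⊆ H)
    (h : ∀ a ∈ H, ∃ s ∈ AddSubgroup.closure E, -s + a ∈ N) : H.FG := by
  have hle : AddSubgroup.closure E ≤ H := (AddSubgroup.closure_le H).mpr hEH
  have : H = AddSubgroup.closure E ⊔ (H ⊓ N) := by
    apply le_antisymm
    · intro a ha
      obtain ⟨s, hs, hsa⟩ := h a ha
      have h1 : -s + a ∈ H ⊓ N := ⟨H.add_mem (H.neg_mem (hle hs)) ha, hsa⟩
      have h2 := AddSubgroup.add_mem_sup hs h1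
      rwa [add_neg_cancel_left] at h2
    · exact sup_le hle inf_le_left
  rw [this]
  exact AddSubgroup.FG.sup ((AddSubgroup.fg_iff _).mpr ⟨E, rfl, hE⟩) hN

theorem AddSubgroup.wellFoundedGT_of_forall_fg {G : Type*} [AddGroup G]
    (h : ∀ H : AddSubgroup G, H.FG) : WellFoundedGT (AddSubgroup G) := by
  rw [wellFoundedGT_iff_monotone_chain_condition]
  intro f
  obtain ⟨E, hE⟩ := h (⨆ n, f n)
  have hdir : Directed (· ≤ ·) f := f.monotone.directed_le
  have hmem : ∀ e ∈ E, ∃ n, e ∈ f n := fun e he => by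
    rw [← AddSubgroup.mem_iSup_of_directed hdir, ← hE]
    exact AddSubgroup.subset_closure he
  choose! n hn using hmem
  refine ⟨E.sup n, fun m hm => le_antisymm (f.monotone hm) ((le_iSup f m).trans ?_)⟩
  rw [← hE, AddSubgroup.closure_le]
  exact fun e he => f.monotone (Finset.le_sup he) (hn e he)

/-- Pigeonhole, for functions recording how an element acts on finitely many generators. -/
theorem Set.Infinite.exists_infinite_fiber {α β ι : Type*} [Finite ι] {S : Set α}
    (hS : S.Infinite) (f : α → ι → β) (F : ι → Set β) (hF : ∀ i, (F i).Finite)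
    (h : ∀ a ∈ S, ∀ i, f a i ∈ F i) : ∃ a₀ ∈ S, {a | a ∈ S ∧ f a = f a₀}.Infinite := by
  by_contra! hcon
  refine hS (Set.Finite.of_finite_fibers f ?_ ?_)
  · refine (Set.Finite.pi' hF).subset ?_
    rintro _ ⟨a, ha, rfl⟩
    exact h a ha
  · rintro _ ⟨a, ha, rfl⟩
    exact hcon a ha

end FinitelyGenerated

/-! ### Almost polycyclic braces: finite generation and the infinite socle. -/

namespace SkewBrace

variable {B : Type*} [SkewBrace B]

theorem PolycyclicStep.fg_of_le {I J : Ideal B} (h : PolycyclicStep I J)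
    (hI : ∀ H : AddSubgroup B, H ≤ I.toAddSubgroup → H.FG) (H : AddSubgroup B)
    (hHJ : H ≤ J.toAddSubgroup) : H.FG := by
  obtain ⟨-, E, hE, hEJ, ⟨hsoc, hgen⟩ | hfin⟩ := h
  · let π := QuotientAddGroup.mk' I.toAddSubgroup
    have hcomm : ∀ a ∈ J.toAddSubgroup.map π, ∀ b ∈ J.toAddSubgroup.map π, a + b = b + a := by
      rintro _ ⟨a, ha, rfl⟩ _ ⟨b, -, rfl⟩
      exact I.toQuot_eq_iff.mpr (hsoc a ha b).2
    have hfg : (J.toAddSubgroup.map π).FG := by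
      refine (AddSubgroup.fg_iff _).mpr ⟨π '' E, le_antisymm ?_ ?_, hE.image π⟩
      · rw [AddSubgroup.closure_le]
        rintro _ ⟨e, he, rfl⟩
        exact ⟨e, hEJ e he, rfl⟩
      · rintro _ ⟨a, ha, rfl⟩
        obtain ⟨s, hs, hsa⟩ := hgen a ha
        rw [← AddMonoidHom.map_closure]
        exact ⟨s, hs, I.toQuot_eq_iff.mpr hsa⟩
    obtain ⟨S, hS⟩ := AddSubgroup.fg_of_le_of_commute hcomm hfg (AddSubgroup.map_mono (f := π) hHJ)
    classical
    obtain ⟨E', hE'H, hE'S⟩ := Finset.subset_set_image_iff.mp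
      (show (S : Set I.Quot) ⊆ π '' (H : Set B) from
        AddSubgroup.subset_closure.trans (SetLike.coe_subset_coe.mpr hS.le))
    refine AddSubgroup.fg_of_fg_inf (hI _ inf_le_right) E'.finite_toSet hE'H fun a ha => ?_
    have h1 : π a ∈ H.map π := ⟨a, ha, rfl⟩
    rw [← hS, ← hE'S, Finset.coe_image, ← AddMonoidHom.map_closure] at h1
    obtain ⟨s, hs, hsa⟩ := h1
    exact ⟨s, hs, I.toQuot_eq_iff.mp hsa⟩
  -- A representative of a coset meeting H is replaced by one lying in H; the default 0 is never
  -- used.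
  · have hex : ∀ e : B, ∃ a : B, (∃ a' ∈ H, -e + a' ∈ I) → a ∈ H ∧ -e + a ∈ I := fun e => by
      by_cases he : ∃ a' ∈ H, -e + a' ∈ I
      · obtain ⟨a, ha⟩ := he
        exact ⟨a, fun _ => ha⟩
      · exact ⟨0, fun h => absurd h he⟩
    choose g hg using hex
    refine AddSubgroup.fg_of_fg_inf (N := I.toAddSubgroup) (hI _ inf_le_right)
      (E := g '' {e ∈ E | ∃ a' ∈ H, -e + a' ∈ I}) ((hE.subset (Set.sep_subset _ _)).image g) ?_ ?_
    · rintro _ ⟨e, he, rfl⟩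
      exact (hg e he.2).1
    · intro a ha
      obtain ⟨e, he, hea⟩ := hfin a (hHJ ha)
      refine ⟨g e, AddSubgroup.subset_closure ⟨e, ⟨he, a, ha, hea⟩, rfl⟩, ?_⟩
      have h1 := add_mem (neg_mem (hg e ⟨a, ha, hea⟩).2) hea
      rwa [neg_add_rev, neg_neg, add_assoc, add_neg_cancel_left] at h1

theorem addSubgroup_fg_of_reflTransGen
    (h : Relation.ReflTransGen PolycyclicStep (⊥ : Ideal B) ⊤) (H : AddSubgroup B) : H.FG := by
  have key : ∀ J : Ideal B, Relation.ReflTransGen PolycyclicStep ⊥ J →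
      ∀ H : AddSubgroup B, H ≤ J.toAddSubgroup → H.FG := by
    intro J hJ
    induction hJ with
    | refl =>
      intro H hH
      rw [show H = ⊥ from le_bot_iff.mp hH]
      exact ⟨∅, by simp⟩
    | tail _ hstep ih => exact hstep.fg_of_le ih
  exact key ⊤ h H fun _ _ => trivial

/-- At the first infinite ideal of the chain the step cannot be finite, so it is a socle step. -/
theorem exists_finite_infinite_socleMod [Infinite B]
    (h : Relation.ReflTransGen PolycyclicStep (⊥ : Ideal B) ⊤) :
    ∃ J A : Ideal B, (J : Set B).Finite ∧ (A : Set B).Infinite ∧ SocleMod J A := by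
  have key : ∀ K : Ideal B, Relation.ReflTransGen PolycyclicStep K ⊤ → (K : Set B).Finite →
      ∃ J A : Ideal B, (J : Set B).Finite ∧ (A : Set B).Infinite ∧ SocleMod J A := by
    intro K hK
    induction hK using Relation.ReflTransGen.head_induction_on with
    | refl => exact fun hfin => absurd hfin Set.infinite_univ
    | @head K K' hstep _ ih =>
      intro hfin
      by_cases hfin' : (K' : Set B).Finite
      · exact ih hfin'
      obtain ⟨-, E, hE, -, ⟨hsoc, -⟩ | hcov⟩ := hstep
      · exact ⟨K, K', hfin, hfin', hsoc⟩
      · refine absurd ((hE.add hfin).subset ?_) hfin'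
        intro a ha
        obtain ⟨e, he, hea⟩ := hcov a ha
        exact ⟨e, he, _, hea, add_neg_cancel_left e a⟩
  exact key ⊥ h (Set.finite_singleton 0)

/-- Conjugation by an element of A keeps each generator e in the finite set e + J, so infinitely
many elements conjugate all generators alike; their differences are central. -/
theorem infinite_inter_center {J A : Ideal B} (hJ : (J : Set B).Finite)
    (hA : (A : Set B).Infinite) (hsoc : SocleMod J A) {E : Finset B}
    (hE : AddSubgroup.closure (E : Set B) = ⊤) :
    {a | a ∈ A ∧ a ∈ AddSubgroup.center B}.Infinite := by
  obtain ⟨a₀, ha₀, hinf⟩ := hA.exists_infinite_fiber (fun a (e : E) => a + e + -a)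
    (fun e => (fun j => (e : B) + j) '' (J : Set B)) (fun e => hJ.image _) (by
      intro a ha e
      refine ⟨a + -(-(a + e) + (e + a)) + -a,
        J.add_conj_mem a (neg_mem (hsoc a ha e).2), ?_⟩
      simp only [neg_add_rev, neg_neg, add_assoc, add_neg_cancel_left])
  refine (hinf.image (f := fun a => -a₀ + a) (add_right_injective _).injOn).mono ?_
  rintro _ ⟨a, ⟨ha, haa⟩, rfl⟩
  refine ⟨add_mem (neg_mem ha₀) ha, ?_⟩
  have hle : AddSubgroup.closure (E : Set B) ≤ AddSubgroup.centralizer {-a₀ + a} := by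
    rw [AddSubgroup.closure_le]
    intro e he
    rw [SetLike.mem_coe, AddSubgroup.mem_centralizer_singleton_iff]
    have h1 : a + e + -a = a₀ + e + -a₀ := congrFun haa ⟨e, he⟩
    have h2 : a + e = a₀ + e + -a₀ + a := by rw [← h1, neg_add_cancel_right]
    rw [add_assoc (-a₀), h2]
    simp only [add_assoc, neg_add_cancel_left]
  rw [hE] at hle
  rw [AddSubgroup.mem_center_iff]
  intro g
  exact (AddSubgroup.mem_centralizer_singleton_iff.mp (hle (AddSubgroup.mem_top g)))

theorem lam_eq_of_eqOn_generators {E : Finset B} (hE : AddSubgroup.closure (E : Set B) = ⊤)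
    {a : B} (h : ∀ e ∈ E, lam a e = e) (b : B) : lam a b = b :=
  DFunLike.congr_fun (AddMonoidHom.eq_of_eqOn_dense hE (f := lamHom a) (g := AddMonoidHom.id B) h) b

/-- An infinite almost polycyclic brace has infinite socle. -/
theorem socle_infinite [Infinite B]
    (h : Relation.ReflTransGen PolycyclicStep (⊥ : Ideal B) ⊤) : (socle B).Infinite := by
  obtain ⟨J, A, hJ, hA, hsoc⟩ := exists_finite_infinite_socleMod h
  obtain ⟨E, hE⟩ := addSubgroup_fg_of_reflTransGen h ⊤
  -- The same pigeonhole for λ: elements c and c₀ acting alike give c₀⁻¹c with trivial λ, still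
  -- central because λ preserves the centre.
  obtain ⟨c₀, hc₀, hinf⟩ := (infinite_inter_center hJ hA hsoc hE).exists_infinite_fiber
    (fun a (e : E) => lam a e) (fun e => (fun j => (e : B) + j) '' (J : Set B))
    (fun e => hJ.image _) (fun a ha e => ⟨_, (hsoc a ha.1 e).1, add_neg_cancel_left _ _⟩)
  refine (hinf.image (f := fun c => c₀⁻¹ * c) (mul_right_injective _).injOn).mono ?_
  rintro _ ⟨c, ⟨hc, hcc⟩, rfl⟩
  refine ⟨lam_eq_of_eqOn_generators hE fun e he => ?_, ?_⟩
  · have h1 : lam c e = lam c₀ e := congrFun hcc ⟨e, he⟩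
    rw [lam_mul, h1, lam_inv_lam]
  · show c₀⁻¹ * c ∈ _
    rw [mul_eq_add_lam, inv_eq_neg_lam_inv]
    exact add_mem (neg_mem (lam_mem_center _ hc₀.2)) (lam_mem_center _ hc.2)

end SkewBrace

namespace SkewBrace

open Polynomial

/-! ### Supersoluble quotients and lattices inside a brace. -/

section Equivariant

variable {B A : Type*} [SkewBrace B] [AddCommGroup A] (ι : A →+ B) (ρ : B →* Module.End ℤ A)

/-- Along a supersoluble chain from `I` to `J`, every `λ_b` acts triangularly. -/
theorem exists_polynomial_aeval_mem_of_reflTransGen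
    (hρ : ∀ b a, ι (ρ b a) = lam b (ι a)) {I J : Ideal B}
    (h : Relation.ReflTransGen SupersolubleStep I J) (b : B) :
    ∃ q : ℤ[X], q.Monic ∧ q.Splits ∧ ∀ a, ι a ∈ J → ι (aeval (ρ b) q a) ∈ I := by
  induction h using Relation.ReflTransGen.head_induction_on with
  | refl => exact ⟨1, monic_one, Splits.one, fun a ha => by rwa [map_one, Module.End.one_apply]⟩
  | @head I K hstep _ ih =>
    obtain ⟨q, hq, hqs, hqK⟩ := ih
    obtain ⟨-, x, hx, -, hgen, -⟩ := hstep
    obtain ⟨c, hc⟩ := exists_lam_eq_zsmul_mod hx hgen b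
    refine ⟨(X - C c) * q, (monic_X_sub_C c).mul hq, (Splits.X_sub_C c).mul hqs, fun a ha => ?_⟩
    have h1 := hc _ (hqK a ha)
    have h2 : aeval (ρ b) ((X - C c) * q) a
        = -(c • aeval (ρ b) q a) + ρ b (aeval (ρ b) q a) := by
      rw [map_mul, map_sub, aeval_X, aeval_C, Module.End.mul_apply, LinearMap.sub_apply,
        Module.algebraMap_end_apply]
      abel
    rwa [h2, map_add, map_neg, map_zsmul, hρ]

/-- The step at which the chain first swallows the image of A supplies the one-dimensional quotient
of A/pA. -/
theorem exists_supersolubleStep_of_not_mem {I : Ideal B}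
    (h : Relation.ReflTransGen SupersolubleStep I ⊤) (hI : ∃ a, ι a ∉ I) :
    ∃ K J : Ideal B, (∀ x ∈ I, x ∈ K) ∧ SupersolubleStep K J ∧ (∃ a, ι a ∉ K) ∧ ∀ a, ι a ∈ J := by
  induction h using Relation.ReflTransGen.head_induction_on with
  | refl => exact absurd trivial hI.choose_spec
  | @head I I' hstep _ ih =>
    by_cases hI' : ∃ a, ι a ∉ I'
    · obtain ⟨K, J, hK, hKJ⟩ := ih hI'
      exact ⟨K, J, fun x hx => hK x (hstep.1 x hx), hKJ⟩
    · push Not at hI'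
      exact ⟨I, I', fun _ => id, hstep, hI, hI'⟩

theorem exists_forall_eq_zsmul_of_reflTransGen [Module.Finite ℤ A] [Module.IsTorsionFree ℤ A]
    [Nontrivial A] (hρ : ∀ b a, ι (ρ b a) = lam b (ι a))
    (hirr : ∀ W : Submodule ℤ A, (∀ b, ∀ w ∈ W, ρ b w ∈ W) → W ≠ ⊥ →
      ∃ k : ℕ, 0 < k ∧ ∀ a : A, (k : ℤ) • a ∈ W)
    (hprime : ∀ p : ℕ, p.Prime → ∃ I : Ideal B, (∀ a, ι a ∈ I ↔ ∃ b, a = (p : ℤ) • b) ∧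
      Relation.ReflTransGen SupersolubleStep I ⊤) (b : B) :
    ∃ c : ℤ, ∀ a, ρ b a = c • a := by
  refine exists_forall_eq_zsmul_of_triangular_mod_primes ρ hirr ?_ ?_ b
  · intro p hp
    obtain ⟨I, hI, hreach⟩ := hprime p hp
    have hne : ∃ a, ι a ∉ I := by
      -- Otherwise A = pA, and the coordinate 1 of a basis vector would be divisible by p.
      by_contra! hall
      have hone : Module.finrank ℤ A ≠ 0 := Module.finrank_pos.ne'
      obtain ⟨i⟩ : Nonempty (Fin (Module.finrank ℤ A)) := ⟨⟨0, Nat.pos_of_ne_zero hone⟩⟩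
      let e := Module.finBasis ℤ A
      obtain ⟨d, hd⟩ := (hI (e i)).mp (hall (e i))
      have h1 := congrArg (fun a => e.repr a i) hd
      simp only [Module.Basis.repr_self, Finsupp.single_eq_same, map_smul, Finsupp.smul_apply,
        smul_eq_mul] at h1
      exact hp.one_lt.ne' (by exact_mod_cast Int.eq_one_of_dvd_one (by positivity) ⟨_, h1⟩)
    obtain ⟨K, J, hIK, ⟨hKJ, x, hx, -, hgen, -⟩, ⟨a₀, ha₀⟩, hJ⟩ :=
      exists_supersolubleStep_of_not_mem ι hreach hne
    refine ⟨AddSubgroup.toIntSubmodule (K.toAddSubgroup.comap ι), fun a => ?_, fun htop => ?_, ?_⟩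
    · exact hIK _ ((hI _).mpr ⟨a, rfl⟩)
    · have : a₀ ∈ AddSubgroup.toIntSubmodule (K.toAddSubgroup.comap ι) := htop ▸ trivial
      exact ha₀ this
    · intro b
      obtain ⟨c, hc⟩ := exists_lam_eq_zsmul_mod hx hgen b
      refine ⟨c, fun a => ?_⟩
      have h1 : ι (-(c • a) + ρ b a) ∈ K := by
        rw [map_add, map_neg, map_zsmul, hρ]
        exact hc _ (hJ a)
      rw [sub_eq_neg_add]
      exact h1
  · intro p hp b
    obtain ⟨I, hI, hreach⟩ := hprime p hp
    obtain ⟨q, hq, hqs, hqI⟩ := exists_polynomial_aeval_mem_of_reflTransGen ι ρ hρ hreach b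
    exact ⟨q, hq, hqs, fun a => (hI _).mp (hqI a trivial)⟩

end Equivariant

/-! ### The socle as a module. -/

section SocleModule

variable {B : Type*} [SkewBrace B]

instance : AddCommGroup (socleIdeal B) :=
  { (inferInstance : AddGroup (socleIdeal B)) with
    add_comm := fun a b => Subtype.ext (AddSubgroup.mem_center_iff.mp b.2.2 a) }

/-- The inclusion of the socle. -/
def socleInclusion (B : Type*) [SkewBrace B] : socleIdeal B →+ B where
  toFun a := a
  map_zero' := rfl
  map_add' _ _ := rfl

/-- The action of a brace on its socle through `λ`. -/
def socleRep (B : Type*) [SkewBrace B] : B →* Module.End ℤ (socleIdeal B) where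
  toFun b := AddMonoidHom.toIntLinearMap
    { toFun := fun a => ⟨lam b a, (socleIdeal B).lam_mem b a.2⟩
      map_zero' := Subtype.ext (map_zero (lamHom b))
      map_add' := fun x y => Subtype.ext (lam_add b x y) }
  map_one' := LinearMap.ext fun a => Subtype.ext (lam_one (a : B))
  map_mul' b c := LinearMap.ext fun a => Subtype.ext (lam_mul b c a)

/-- Invariant submodules of the socle are ideals. -/
def Ideal.ofSubmodule (W : Submodule ℤ (socleIdeal B)) (hW : ∀ b, ∀ w ∈ W, socleRep B b w ∈ W) :
    Ideal B :=
  Ideal.ofSocleMod socleMod_bot_socleIdeal (W.toAddSubgroup.map (socleInclusion B))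
    (by
      rintro _ rfl
      exact zero_mem _)
    (by
      rintro _ ⟨w, -, rfl⟩
      exact w.2)
    (by
      rintro b _ ⟨w, hw, rfl⟩
      exact ⟨_, hW b w hw, rfl⟩)

theorem Ideal.mem_ofSubmodule {W : Submodule ℤ (socleIdeal B)}
    {hW : ∀ b, ∀ w ∈ W, socleRep B b w ∈ W} {x : B} :
    x ∈ Ideal.ofSubmodule W hW ↔ ∃ w ∈ W, socleInclusion B w = x := Iff.rfl

theorem Ideal.socleInclusion_mem_ofSubmodule {W : Submodule ℤ (socleIdeal B)}
    {hW : ∀ b, ∀ w ∈ W, socleRep B b w ∈ W} {x : socleIdeal B} :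
    socleInclusion B x ∈ Ideal.ofSubmodule W hW ↔ x ∈ W := by
  rw [Ideal.mem_ofSubmodule]
  constructor
  · rintro ⟨w, hw, h⟩
    rwa [← Subtype.ext (a1 := w) (a2 := x) h]
  · exact fun h => ⟨x, h, rfl⟩

theorem Ideal.ofSubmodule_ne_bot {W : Submodule ℤ (socleIdeal B)}
    {hW : ∀ b, ∀ w ∈ W, socleRep B b w ∈ W} (h : W ≠ ⊥) : Ideal.ofSubmodule W hW ≠ ⊥ := by
  obtain ⟨w, hw, hw0⟩ := W.ne_bot_iff.mp h
  intro h0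
  exact hw0 (Subtype.ext (Ideal.eq_bot_iff.mp h0 w ⟨w, hw, rfl⟩))

end SocleModule

/-- For m the order of the finite torsion submodule, mM is torsion-free; it is nonzero, since a
finitely generated torsion group is finite. -/
theorem Module.exists_smul_torsionFree {M : Type*} [AddCommGroup M] [Module.Finite ℤ M]
    [Infinite M] : ∃ m : ℤ, (∃ a : M, m • a ≠ 0) ∧
      ∀ (k : ℤ) (a : M), k • m • a = 0 → k = 0 ∨ m • a = 0 := by
  have hfin : Finite (Submodule.torsion ℤ M) :=
    Module.finite_of_fg_torsion _ Submodule.torsion_isTorsion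
  set m := Nat.card (Submodule.torsion ℤ M) with hm
  have hm0 : (m : ℤ) ≠ 0 := by exact_mod_cast Nat.card_pos.ne'
  have htor : ∀ (k : ℤ) (a : M), k ≠ 0 → k • a = 0 → (m : ℤ) • a = 0 := by
    intro k a hk hka
    have hmem : a ∈ Submodule.torsion ℤ M :=
      (Submodule.mem_torsion_iff a).mpr ⟨⟨k, mem_nonZeroDivisors_of_ne_zero hk⟩, hka⟩
    have h1 := card_nsmul_eq_zero' (x := (⟨a, hmem⟩ : Submodule.torsion ℤ M))
    rw [natCast_zsmul]
    exact congrArg Subtype.val h1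
  refine ⟨m, ?_, fun k a hka => ?_⟩
  · by_contra! hall
    have : Module.IsTorsion ℤ M := fun {a} => ⟨⟨m, mem_nonZeroDivisors_of_ne_zero hm0⟩, hall a⟩
    have := Module.finite_of_fg_torsion M this
    exact not_finite M
  · by_cases hk : k = 0
    · exact Or.inl hk
    · exact Or.inr (htor (k * m) a (mul_ne_zero hk hm0) (by rw [mul_smul]; exact hka))

/-! ### The induction. -/

section Core

variable {B : Type*} [SkewBrace B]

/-- Among the nonzero torsion-free invariant submodules of an infinite finitely generated socle
there is one which is rationally irreducible. -/
theorem exists_rationally_irreducible [Module.Finite ℤ (socleIdeal B)] [Infinite (socleIdeal B)] :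
    ∃ W : Submodule ℤ (socleIdeal B), (∀ b, ∀ w ∈ W, socleRep B b w ∈ W) ∧ W ≠ ⊥ ∧
      (∀ (k : ℤ), ∀ w ∈ W, k • w = 0 → k = 0 ∨ w = 0) ∧
      ∀ V : Submodule ℤ (socleIdeal B), (∀ b, ∀ v ∈ V, socleRep B b v ∈ V) → V ≠ ⊥ → V ≤ W →
        ∃ k : ℕ, 0 < k ∧ ∀ w ∈ W, (k : ℤ) • w ∈ V := by
  let P : Submodule ℤ (socleIdeal B) → Prop := fun W =>
    (∀ b, ∀ w ∈ W, socleRep B b w ∈ W) ∧ W ≠ ⊥ ∧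
      (∀ (k : ℤ), ∀ w ∈ W, k • w = 0 → k = 0 ∨ w = 0)
  have hex : ∃ n : ℕ, ∃ W, P W ∧ Module.finrank ℤ W = n := by
    obtain ⟨m, ⟨a, ha⟩, hm⟩ := Module.exists_smul_torsionFree (M := socleIdeal B)
    refine ⟨_, LinearMap.range (LinearMap.lsmul ℤ (socleIdeal B) m), ⟨?_, ?_, ?_⟩, rfl⟩
    · rintro b _ ⟨w, rfl⟩
      exact ⟨socleRep B b w, (map_smul _ _ _).symm⟩
    · exact (Submodule.ne_bot_iff _).mpr ⟨_, ⟨a, rfl⟩, ha⟩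
    · rintro k _ ⟨w, rfl⟩ h
      exact hm k w h
  classical
  -- By minimality of the rank, a nonzero invariant V inside W has the same rank; W/V is then finite
  -- and its order serves as k.
  obtain ⟨W, ⟨hW, hW0, htf⟩, hrank⟩ := Nat.find_spec hex
  refine ⟨W, hW, hW0, htf, fun V hV hV0 hVW => ?_⟩
  have hle : Module.finrank ℤ W ≤ Module.finrank ℤ V := by
    rw [hrank]
    exact Nat.find_min' hex ⟨V, ⟨hV, hV0, fun k v hv => htf k v (hVW hv)⟩, rfl⟩
  have htfW : Module.IsTorsionFree ℤ W := by
    rw [Module.isTorsionFree_iff_smul_eq_zero]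
    intro k w h
    exact (htf k w w.2 (congrArg Subtype.val h)).imp id fun h => Subtype.ext h
  let V' : Submodule ℤ W := V.comap W.subtype
  have hV' : Module.finrank ℤ V' = Module.finrank ℤ W := by
    rw [(Submodule.comapSubtypeEquivOfLe hVW).finrank_eq]
    exact le_antisymm (Submodule.finrank_mono hVW) hle
  have hfin : Finite (W ⧸ V') := Submodule.finiteQuotientOfFreeOfRankEq V' hV'
  refine ⟨Nat.card (W ⧸ V'), Nat.card_pos, fun w hw => ?_⟩
  have h1 := card_nsmul_eq_zero' (x := (V'.mkQ ⟨w, hw⟩))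
  rw [← map_nsmul, Submodule.mkQ_apply, Submodule.Quotient.mk_eq_zero, ← natCast_zsmul] at h1
  exact h1

/-- If all proper quotients of an infinite almost polycyclic brace are supersoluble, so is the
brace itself. -/
theorem reflTransGen_bot_top_of_forall_ne_bot [Infinite B]
    (hAP : Relation.ReflTransGen PolycyclicStep (⊥ : Ideal B) ⊤)
    (h : ∀ I : Ideal B, I ≠ ⊥ → Relation.ReflTransGen SupersolubleStep I ⊤) :
    Relation.ReflTransGen SupersolubleStep (⊥ : Ideal B) ⊤ := by
  have : Infinite (socleIdeal B) := (socle_infinite hAP).to_subtype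
  have : Module.Finite ℤ (socleIdeal B) := Module.Finite.iff_addGroup_fg.mpr
    ((AddGroup.fg_iff_addSubgroup_fg (socleIdeal B).toAddSubgroup).mpr
      (addSubgroup_fg_of_reflTransGen hAP _))
  obtain ⟨W, hW, hW0, htf, hirr⟩ := exists_rationally_irreducible (B := B)
  have htfW : Module.IsTorsionFree ℤ W := by
    rw [Module.isTorsionFree_iff_smul_eq_zero]
    intro k w h
    exact (htf k w w.2 (congrArg Subtype.val h)).imp id fun h => Subtype.ext h
  have hnt : Nontrivial W := Submodule.nontrivial_iff_ne_bot.mpr hW0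
  let ι : W →+ B := (socleInclusion B).comp W.subtype.toAddMonoidHom
  let ρ : B →* Module.End ℤ W :=
    { toFun := fun b => (socleRep B b).restrict (hW b)
      map_one' := LinearMap.ext fun w => Subtype.ext
        (LinearMap.congr_fun (map_one (socleRep B)) (w : socleIdeal B))
      map_mul' := fun b c => LinearMap.ext fun w => Subtype.ext
        (LinearMap.congr_fun (map_mul (socleRep B) b c) (w : socleIdeal B)) }
  have hscalar := exists_forall_eq_zsmul_of_reflTransGen ι ρ (fun _ _ => rfl) (by
    intro V hV hV0
    obtain ⟨k, hk, hkV⟩ := hirr (V.map W.subtype) (by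
        rintro b _ ⟨v, hv, rfl⟩
        exact ⟨_, hV b v hv, rfl⟩)
      (by
        obtain ⟨v, hv, hv0⟩ := V.ne_bot_iff.mp hV0
        exact (Submodule.ne_bot_iff _).mpr ⟨v, ⟨v, hv, rfl⟩, fun h0 => hv0 (Subtype.ext h0)⟩)
      (Submodule.map_subtype_le W V)
    refine ⟨k, hk, fun w => ?_⟩
    obtain ⟨v, hv, hvw⟩ := hkV w w.2
    rwa [← Subtype.ext (a1 := v) (a2 := (k : ℤ) • w) hvw]) (by
    intro p hp
    have hp0 : (p : ℤ) ≠ 0 := by exact_mod_cast hp.ne_zero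
    -- The subgroup pW is a nonzero ideal, so the quotient by it is supersoluble by hypothesis.
    let V := W.map (LinearMap.lsmul ℤ (socleIdeal B) p)
    have hV : ∀ b, ∀ v ∈ V, socleRep B b v ∈ V := by
      rintro b _ ⟨w, hw, rfl⟩
      exact ⟨_, hW b w hw, (map_smul _ _ _).symm⟩
    have hV0 : V ≠ ⊥ := by
      obtain ⟨w, hw, hw0⟩ := W.ne_bot_iff.mp hW0
      refine V.ne_bot_iff.mpr ⟨_, ⟨w, hw, rfl⟩, fun h0 => ?_⟩
      exact (htf p w hw h0).elim hp0 hw0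
    refine ⟨Ideal.ofSubmodule V hV, fun a => ?_, h _ (Ideal.ofSubmodule_ne_bot hV0)⟩
    refine Ideal.socleInclusion_mem_ofSubmodule.trans ⟨?_, ?_⟩
    · rintro ⟨w, hw, hwa⟩
      exact ⟨⟨w, hw⟩, Subtype.ext hwa.symm⟩
    · rintro ⟨w, rfl⟩
      exact ⟨w, w.2, rfl⟩)
  obtain ⟨w, hw, hw0⟩ := W.ne_bot_iff.mp hW0
  -- As B acts on W by scalars, the line through any nonzero w is invariant. It is the infinite
  -- cyclic first step of the chain.
  let L : Submodule ℤ (socleIdeal B) := Submodule.span ℤ {w}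
  have hL : ∀ b, ∀ v ∈ L, socleRep B b v ∈ L := by
    intro b v hv
    obtain ⟨k, rfl⟩ := Submodule.mem_span_singleton.mp hv
    obtain ⟨c, hc⟩ := hscalar b
    have h1 : socleRep B b w = c • w := congrArg Subtype.val (hc ⟨w, hw⟩)
    rw [map_smul, h1]
    exact L.smul_mem _ (L.smul_mem _ (Submodule.mem_span_singleton_self w))
  have hL0 : L ≠ ⊥ := L.ne_bot_iff.mpr ⟨w, Submodule.mem_span_singleton_self w, hw0⟩
  refine .head ?_ (h _ (Ideal.ofSubmodule_ne_bot (hW := hL) hL0))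
  refine ⟨?_, socleInclusion B w, ⟨w, Submodule.mem_span_singleton_self w, rfl⟩, 0, ?_, ?_,
    Or.inl ⟨rfl, ?_⟩⟩
  · rintro _ rfl
    exact zero_mem _
  · rintro _ ⟨v, hv, rfl⟩
    obtain ⟨k, rfl⟩ := Submodule.mem_span_singleton.mp hv
    refine ⟨k, ?_⟩
    rw [Ideal.mem_bot, map_zsmul, neg_add_cancel]
  · intro k
    rw [Ideal.mem_bot, ← map_zsmul, Nat.cast_zero, zero_dvd_iff]
    constructor
    · intro h0
      exact (htf k w hw (Subtype.ext h0)).resolve_right hw0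
    · rintro rfl
      rw [zero_smul, map_zero]
  · rintro _ ⟨v, -, rfl⟩ b
    exact socleMod_bot_socleIdeal _ v.2 b

/-- Noetherian induction: ideals of finite index are covered by hypothesis, and for the others every
nonzero ideal of the infinite quotient pulls back to a strictly larger ideal. -/
theorem reflTransGen_top_of_forall_finite
    (hAP : Relation.ReflTransGen PolycyclicStep (⊥ : Ideal B) ⊤)
    (h : ∀ I : Ideal B, Finite I.Quot → Relation.ReflTransGen SupersolubleStep I ⊤)
    (I : Ideal B) : Relation.ReflTransGen SupersolubleStep I ⊤ := by
  have hwf : WellFoundedGT (AddSubgroup B) :=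
    AddSubgroup.wellFoundedGT_of_forall_fg (addSubgroup_fg_of_reflTransGen hAP)
  induction I using (InvImage.wf (fun I : Ideal B => I.toAddSubgroup) hwf.wf).induction with
  | _ I ih =>
    by_cases hfin : Finite I.Quot
    · exact h I hfin
    have : Infinite I.Quot := not_finite_iff_infinite.mp hfin
    have hsurj := I.quotHom_surjective
    have key := reflTransGen_bot_top_of_forall_ne_bot
      (I.quotHom.reflTransGen_polycyclicStep hsurj hAP) (fun K hK => by
        rw [← I.quotHom.reflTransGen_supersolubleStep_comap_iff hsurj]
        refine ih _ (lt_of_le_of_ne ?_ ?_)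
        · intro a ha
          exact (I.quotHom.mem_comap).mpr (by
            rw [show I.quotHom.addHom a = 0 from I.toQuot_eq_zero_iff.mpr ha]
            exact zero_mem K)
        · intro heq
          apply hK
          rw [Ideal.eq_bot_iff]
          intro c hc
          obtain ⟨a, rfl⟩ := hsurj c
          have h1 : a ∈ I.toAddSubgroup := by
            have heq' : I.toAddSubgroup = (I.quotHom.comap K).toAddSubgroup := heq
            rw [heq']
            exact hc
          exact I.toQuot_eq_zero_iff.mpr h1)
    rwa [← I.quotHom.reflTransGen_supersolubleStep_comap_iff hsurj, I.comap_quotHom_bot] at key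

end Core

end SkewBrace

/-! ### The main theorem. -/

theorem theorem3p45 {B : Type u} [SkewBrace B] (hB : SkewBrace.IsAlmostPolycyclic B) :
    SkewBrace.IsSupersoluble B ↔
      ∀ (C : Type u) [SkewBrace C] [Finite C] (f : SkewBrace.BraceHom B C),
        Function.Surjective f.toFun → SkewBrace.IsSupersoluble C := by
  constructor
  · intro h C _ _ f hf
    exact f.isSupersoluble_of_finite hf h
  · intro h
    rw [SkewBrace.isSupersoluble_iff]
    refine SkewBrace.reflTransGen_top_of_forall_finite hB.reflTransGen (fun I hfin => ?_) ⊥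
    have hI := h I.Quot I.quotHom I.quotHom_surjective
    rwa [SkewBrace.isSupersoluble_iff,
      ← I.quotHom.reflTransGen_supersolubleStep_comap_iff I.quotHom_surjective,
      I.comap_quotHom_bot] at hI
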